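/- **Conventions.** Let $G$ be a group. A $G$-tree is a simplicial tree with a simplicial action of $G$ without edge inversions; it is non-trivial if no vertex stabiliser is equal to $G$, and a subgroup of $G$ is elliptic in it if it fixes a vertex. If $\mathcal H$ is a set of subgroups of $G$, then $G$ *splits over a finite subgroup relative to* $\mathcal H$ if there is a non-trivial $G$-tree with finite edge stabilisers in which every member of $\mathcal H$ is elliptic. The group $G$ is *one-ended* if it is infinite and does not split over a finite subgroup (relative to $\varnothing$); it is *two-ended* if it has an infinite cyclic subgroup of finite index; it is *infinite-ended* if it is infinite and neither one-ended nor two-ended. A *trivial vertex* of a graph of groups is a vertex of degree one (a loop counts twice) whose vertex group is equal to the image of the incident edge group. The incident edge groups of a vertex group are the images in it of the edge groups of the edges incident to the vertex (a loop gives two such subgroups). **Theorem.** Let $\Gamma$ be the fundamental group of a finite connected graph of groups with two-ended edge groups and no trivial vertices. If the graph has no edges (so that it is a single vertex with group $\Gamma$), assume moreover that $\Gamma$ is infinite and not two-ended. Then $\Gamma$ is one-ended if and only if no infinite-ended vertex group splits over a finite subgroup relative to its incident edge groups. -/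

import Mathlib

universe u

/-- A `G`-tree: a simplicial tree with a simplicial action of `G` without edge inversions. -/
structure GTree (G : Type u) [Group G] where
  /-- the set of vertices -/
  X : Type u
  /-- the edges -/
  graph : SimpleGraph X
  isTree : graph.IsTree
  [action : MulAction G X]
  adj_smul : ∀ (g : G) (x y : X), graph.Adj x y → graph.Adj (g • x) (g • y)
  no_inversion : ∀ (g : G) (x y : X), graph.Adj x y → ¬ (g • x = y ∧ g • y = x)

namespace GTree

attribute [instance] GTree.action

variable {G : Type u} [Group G] (T : GTree G)

/-- The stabiliser of the edge `{x, y}`; as there are no inversions it fixes both ends. -/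
def edgeStabilizer (x y : T.X) : Subgroup G :=
  MulAction.stabilizer G x ⊓ MulAction.stabilizer G y

/-- All edge stabilisers are finite. -/
def FiniteEdgeStabilizers : Prop :=
  ∀ x y : T.X, T.graph.Adj x y → Finite (T.edgeStabilizer x y)

/-- No vertex stabiliser is the whole group. -/
def Nontrivial : Prop :=
  ∀ x : T.X, MulAction.stabilizer G x ≠ ⊤

/-- A subgroup is elliptic if it lies in some vertex stabiliser. -/
def Elliptic (H : Subgroup G) : Prop :=
  ∃ x : T.X, H ≤ MulAction.stabilizer G x

end GTree

/-- `G` splits non-trivially over a finite subgroup relative to the set `𝓗` of subgroups: there is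
a non-trivial `G`-tree with finite edge stabilisers in which every member of `𝓗` is elliptic. -/
def SplitsOverFiniteRel (G : Type u) [Group G] (𝓗 : Set (Subgroup G)) : Prop :=
  ∃ T : GTree G, T.Nontrivial ∧ T.FiniteEdgeStabilizers ∧ ∀ H ∈ 𝓗, T.Elliptic H

/-- A group is one-ended if it is infinite and does not split non-trivially over any finite
subgroup. -/
def IsOneEnded (G : Type u) [Group G] : Prop :=
  Infinite G ∧ ¬ SplitsOverFiniteRel G ∅

/-- A group is two-ended if it has an infinite cyclic subgroup of finite index. -/
def IsTwoEnded (G : Type u) [Group G] : Prop :=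
  ∃ g : G, ¬ IsOfFinOrder g ∧ (Subgroup.zpowers g).FiniteIndex

/-- A group is infinite-ended if it is infinite and neither one-ended nor two-ended. -/
def IsInfiniteEnded (G : Type u) [Group G] : Prop :=
  Infinite G ∧ ¬ IsOneEnded G ∧ ¬ IsTwoEnded G

/-- A graph of groups on the vertex set `V` and the edge set `E`. Loops and multiple edges are
allowed. The edge `e` runs from `ends e false` to `ends e true`; a pair `(e, b)` is a half-edge,
incident to the vertex `ends e b`. Its underlying graph is not required to be connected here. -/
structure GraphOfGroups (V E : Type u) where
  ends : E → Bool → V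
  /-- vertex groups -/
  VG : V → Type u
  /-- edge groups -/
  EG : E → Type u
  [groupVG : ∀ v, Group (VG v)]
  [groupEG : ∀ e, Group (EG e)]
  /-- the monomorphisms of the edge groups into the vertex groups at the two ends -/
  incl : ∀ (e : E) (b : Bool), EG e →* VG (ends e b)
  incl_injective : ∀ (e : E) (b : Bool), Function.Injective (incl e b)

namespace GraphOfGroups

attribute [instance] GraphOfGroups.groupVG GraphOfGroups.groupEG

variable {V E : Type u} (𝒢 : GraphOfGroups V E)

/-- The underlying graph is connected (and non-empty). -/
def Connected : Prop :=
  (SimpleGraph.fromRel fun v w => ∃ e, 𝒢.ends e false = v ∧ 𝒢.ends e true = w).Connected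

/-- `𝒢.IsIncidentEdgeGroup v H`: the subgroup `H` of the vertex group at `v` is the image of an edge
group under the monomorphism belonging to a half-edge at `v`. A loop at `v` contributes two
subgroups. -/
inductive IsIncidentEdgeGroup : ∀ v : V, Subgroup (𝒢.VG v) → Prop
  | mk (e : E) (b : Bool) : IsIncidentEdgeGroup (𝒢.ends e b) (𝒢.incl e b).range

/-- The set of incident edge groups of the vertex group at `v`. -/
def incidentEdgeGroups (v : V) : Set (Subgroup (𝒢.VG v)) :=
  {H | 𝒢.IsIncidentEdgeGroup v H}

/-- A trivial vertex: a vertex of degree one (exactly one half-edge is incident to it) whose vertex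
group equals the incident edge group. -/
def IsTrivialVertex (v : V) : Prop :=
  ∃ (e : E) (b : Bool), 𝒢.ends e b = v ∧
    (∀ (e' : E) (b' : Bool), 𝒢.ends e' b' = v → e' = e ∧ b' = b) ∧
    Function.Surjective (𝒢.incl e b)

/-- The free product of all vertex groups and of the free group on the edges. -/
abbrev FreeProd : Type u :=
  Monoid.Coprod (Monoid.CoprodI 𝒢.VG) (FreeGroup E)

/-- An element of a vertex group in the free product. -/
def ofVertex₀ (v : V) (g : 𝒢.VG v) : 𝒢.FreeProd :=
  Monoid.Coprod.inl (Monoid.CoprodI.of g)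

/-- The stable letter of an edge in the free product. -/
def ofEdge₀ (e : E) : 𝒢.FreeProd :=
  Monoid.Coprod.inr (FreeGroup.of e)

/-- The relators `tₑ · ι₁(a) · tₑ⁻¹ · ι₀(a)⁻¹`, for `a` in the edge group of `e`, where `ι₀` and `ι₁`
are the monomorphisms into the groups at the origin and at the terminus of `e`. -/
def relators : Set 𝒢.FreeProd :=
  {r | ∃ (e : E) (a : 𝒢.EG e),
    r = 𝒢.ofEdge₀ e * 𝒢.ofVertex₀ _ (𝒢.incl e true a) * (𝒢.ofEdge₀ e)⁻¹ *
      (𝒢.ofVertex₀ _ (𝒢.incl e false a))⁻¹}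

/-- The path group of the graph of groups. -/
abbrev PathGroup : Type u :=
  𝒢.FreeProd ⧸ Subgroup.normalClosure 𝒢.relators

/-- An element of a vertex group in the path group. -/
def ofVertex (v : V) (g : 𝒢.VG v) : 𝒢.PathGroup :=
  QuotientGroup.mk' (Subgroup.normalClosure 𝒢.relators) (𝒢.ofVertex₀ v g)

/-- The stable letter of an edge in the path group. -/
def ofEdge (e : E) : 𝒢.PathGroup :=
  QuotientGroup.mk' (Subgroup.normalClosure 𝒢.relators) (𝒢.ofEdge₀ e)

/-- `𝒢.IsPath v w x`: the element `x` of the path group is represented by a word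
`g₀ t₁ g₁ t₂ ⋯ tₙ gₙ`, where `t₁, …, tₙ` are the letters (or inverse letters) of the successive edges
of an edge path from `v` to `w`, and where `gᵢ` lies in the group of the `i`-th vertex on it. -/
inductive IsPath (v : V) : V → 𝒢.PathGroup → Prop
  | nil : IsPath v v 1
  | vertex {w : V} {x : 𝒢.PathGroup} (h : IsPath v w x) (g : 𝒢.VG w) :
      IsPath v w (x * 𝒢.ofVertex w g)
  | edge {x : 𝒢.PathGroup} (e : E) (h : IsPath v (𝒢.ends e false) x) :
      IsPath v (𝒢.ends e true) (x * 𝒢.ofEdge e)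
  | edgeInv {x : 𝒢.PathGroup} (e : E) (h : IsPath v (𝒢.ends e true) x) :
      IsPath v (𝒢.ends e false) (x * (𝒢.ofEdge e)⁻¹)

variable {𝒢}

theorem IsPath.trans {u v w : V} {x y : 𝒢.PathGroup} (hx : 𝒢.IsPath u v x)
    (hy : 𝒢.IsPath v w y) : 𝒢.IsPath u w (x * y) := by
  induction hy with
  | nil => simpa using hx
  | vertex _ g ih => rw [← mul_assoc]; exact ih.vertex g
  | edge e _ ih => rw [← mul_assoc]; exact ih.edge e
  | edgeInv e _ ih => rw [← mul_assoc]; exact ih.edgeInv e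

theorem ofVertex_inv (v : V) (g : 𝒢.VG v) : (𝒢.ofVertex v g)⁻¹ = 𝒢.ofVertex v g⁻¹ := by
  simp only [ofVertex, ofVertex₀, map_inv]

theorem IsPath.symm {v w : V} {x : 𝒢.PathGroup} (hx : 𝒢.IsPath v w x) :
    𝒢.IsPath w v x⁻¹ := by
  induction hx with
  | nil => simpa using IsPath.nil
  | vertex _ g ih =>
    rw [mul_inv_rev, ofVertex_inv]
    have h := (IsPath.nil (𝒢 := 𝒢)).vertex g⁻¹
    rw [one_mul] at h
    exact h.trans ih
  | edge e _ ih =>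
    rw [mul_inv_rev]
    have h := (IsPath.nil (𝒢 := 𝒢)).edgeInv e
    rw [one_mul] at h
    exact h.trans ih
  | edgeInv e _ ih =>
    rw [mul_inv_rev, inv_inv]
    have h := (IsPath.nil (𝒢 := 𝒢)).edge e
    rw [one_mul] at h
    exact h.trans ih

variable (𝒢)

/-- The fundamental group of the graph of groups at the base vertex `v₀`: the subgroup of the path
group that consists of the elements represented by closed paths at `v₀`. -/
def fundamentalGroup (v₀ : V) : Subgroup 𝒢.PathGroup where
  carrier := {x | 𝒢.IsPath v₀ v₀ x}
  mul_mem' hx hy := IsPath.trans hx hy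
  one_mem' := IsPath.nil
  inv_mem' hx := IsPath.symm hx

end GraphOfGroups

/-!
The proof works with the actions of `Γ` and of the vertex groups on trees.

If a vertex group splits relative to its incident edge groups, then the edges of the graph of groups
can be attached to fixed points of their groups in the tree of the splitting, so that the vertex of
the Bass–Serre tree can be blown up to that tree. Collapsing the old edges shows that `Γ` splits
(`GraphOfGroups.splits_of_vertexGroup_splits`).

Conversely, let `T` be a `Γ`-tree with finite edge stabilisers. If the edge groups are elliptic
in `T`, then so is each vertex group, since otherwise it would be infinite-ended and `T` would be a
splitting of it relative to its incident edge groups. An infinite subgroup fixes at most one vertex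
of `T`, so that adjacent vertex groups fix the same vertex, and hence `Γ` fixes it
(`GraphOfGroups.not_nontrivial_of_not_splits`). If some edge group is not elliptic, then it has an
axis in `T`. Let `xy` be an edge of `T` on this axis. Only finitely many edges of the Bass–Serre tree
have an axis that contains `xy`. They form a forest, and a finite forest has a leaf: a vertex, with
group `G` say, at which exactly one edge, with group `C`, is of this kind
(`GraphOfGroups.exists_forest_leaf`). Then the `G`-translates of the axis of `C` are lines of which
exactly one contains `xy`, and no axis of another incident edge group meets the orbit of `xy`. Collapse
the other edges of `T`, and replace each of these lines by a star. The result is a tree, the tree of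
lines, in which all incident edge groups are elliptic; it shows that `G` splits relative to them,
unless `G` is two-ended (`GTree.FiniteEdgeStabilizers.splits_of_onAxis`). In a two-ended group all
infinite subgroups have the same axis, so that then the vertex has degree one and `G = C`, that is,
the vertex is trivial (`GraphOfGroups.exists_splits_of_not_elliptic`).

Normal forms for the path group are not needed. The vertex groups inject because the path group acts
by permutations of a large set on which all vertex groups act freely
(`GraphOfGroups.ofVertexHom_injective`). The Bass–Serre forest and the blow-up are acyclic because
across each edge a function changes that is constant across all other edges; such functions come from
derivations of the path group with values in functions mod 2, which may be prescribed on the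
generators (`GraphOfGroups.exists_derivation`).
-/

/-! ### Half-trees -/

namespace SimpleGraph

variable {V : Type*} {G : SimpleGraph V}

/-- The half-tree cut off by the edge from `x` to `y`: the vertices closer to `y` than to `x`. -/
def halfTree (G : SimpleGraph V) (x y : V) : Set V :=
  {q | G.dist q y < G.dist q x}

theorem mem_halfTree {x y q : V} : q ∈ G.halfTree x y ↔ G.dist q y < G.dist q x := Iff.rfl

theorem IsTree.mem_halfTree_swap (hG : G.IsTree) {x y : V} (h : G.Adj x y) (q : V) :
    q ∈ G.halfTree y x ↔ q ∉ G.halfTree x y := by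
  have := hG.dist_ne_of_adj q h
  simp only [mem_halfTree]
  lia

theorem IsTree.target_mem_halfTree {x y : V} (hG : G.IsTree) (h : G.Adj x y) :
    y ∈ G.halfTree x y := by
  rw [mem_halfTree, dist_self]
  exact hG.connected.pos_dist_of_ne h.ne'

theorem source_notMem_halfTree {x y : V} : x ∉ G.halfTree x y := by
  simp [mem_halfTree]

theorem dist_of_mem_halfTree {x y q : V} (h : G.Adj x y) (hq : q ∈ G.halfTree x y) :
    G.dist q x = G.dist q y + 1 := by
  rw [mem_halfTree] at hq
  have := h.diff_dist_adj (u := q)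
  lia

/-- A vertex of the half-tree is joined to its root `y` avoiding the edge `xy`. -/
theorem IsTree.reachable_of_mem_halfTree (hG : G.IsTree) {x y q : V}
    (hq : q ∈ G.halfTree x y) : (G.deleteEdges {s(x, y)}).Reachable q y := by
  classical
  obtain ⟨p, hp⟩ := hG.connected.exists_walk_length_eq_dist q y
  have hx : x ∉ p.support := by
    intro hx
    have h1 := dist_le (p.takeUntil x hx)
    have h2 := p.length_takeUntil_le_length hx
    rw [mem_halfTree] at hq
    lia
  refine ⟨p.toDeleteEdges _ ?_⟩
  intro e he he'
  rw [Set.mem_singleton_iff] at he'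
  subst he'
  exact hx (p.fst_mem_support_of_mem_edges he)

/-- The only edge with exactly one end in the half-tree of `xy` is `xy`. -/
theorem IsTree.mem_halfTree_iff_of_adj (hG : G.IsTree) {x y q q' : V} (h : G.Adj x y)
    (hq : G.Adj q q') (hne : s(q, q') ≠ s(x, y)) :
    q ∈ G.halfTree x y ↔ q' ∈ G.halfTree x y := by
  have hb : ¬ (G.deleteEdges {s(x, y)}).Reachable x y :=
    isBridge_iff.1 (isAcyclic_iff_forall_adj_isBridge.1 hG.isAcyclic h)
  have hqq : (G.deleteEdges {s(x, y)}).Reachable q q' :=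
    Adj.reachable (by simpa [deleteEdges_adj] using ⟨hq, by simpa using hne⟩)
  have key : ∀ q q' : V, (G.deleteEdges {s(x, y)}).Reachable q q' → q ∈ G.halfTree x y →
      q' ∈ G.halfTree x y := by
    intro q q' hqq h1
    by_contra h2
    have h3 := hG.reachable_of_mem_halfTree ((hG.mem_halfTree_swap h q').2 h2)
    rw [Sym2.eq_swap] at h3
    exact hb ((h3.symm.trans hqq.symm).trans (hG.reachable_of_mem_halfTree h1))
  exact ⟨key _ _ hqq, key _ _ hqq.symm⟩

theorem Connected.exists_adj_dist_lt (hG : G.Connected) {p q : V} (h : p ≠ q) :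
    ∃ y, G.Adj p y ∧ q ∈ G.halfTree p y := by
  obtain ⟨w, hw⟩ := hG.exists_walk_length_eq_dist p q
  cases w with
  | nil => exact absurd rfl h
  | cons hadj w' =>
    rename_i y
    refine ⟨y, hadj, ?_⟩
    rw [mem_halfTree, dist_comm, dist_comm (u := q)]
    have := dist_le w'
    simp only [Walk.length_cons] at hw
    lia

/-- Only finitely many edges separate two given vertices. -/
theorem IsTree.finite_separating (hG : G.IsTree) (p q : V) :
    {e : V × V | G.Adj e.1 e.2 ∧ ¬ (p ∈ G.halfTree e.1 e.2 ↔ q ∈ G.halfTree e.1 e.2)}.Finite := by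
  obtain ⟨w⟩ := hG.connected p q
  induction w with
  | nil => simp
  | cons hadj w ih =>
    rename_i a b c
    refine ((Set.toFinite {(a, b), (b, a)}).union ih).subset ?_
    rintro ⟨x, y⟩ ⟨h1, h2⟩
    by_cases h3 : s(a, b) = s(x, y)
    · left
      rcases Sym2.eq_iff.1 h3 with ⟨rfl, rfl⟩ | ⟨rfl, rfl⟩ <;> simp
    · right
      refine ⟨h1, fun h4 => h2 ?_⟩
      exact (hG.mem_halfTree_iff_of_adj h1 hadj h3).trans h4

/-- An acyclicity criterion: each edge is the only one across which a suitable function changes. -/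
theorem isAcyclic_of_cuts {α : Type*}
    (h : ∀ x y, G.Adj x y → ∃ c : V → α, c x ≠ c y ∧
      ∀ q q', G.Adj q q' → s(q, q') ≠ s(x, y) → c q = c q') : G.IsAcyclic := by
  rw [isAcyclic_iff_forall_adj_isBridge]
  intro x y hxy
  rw [isBridge_iff]
  rintro ⟨w⟩
  obtain ⟨c, hc, hc'⟩ := h x y hxy
  have key : ∀ q q' : V, (G.deleteEdges {s(x, y)}).Walk q q' → c q = c q' := by
    intro q q' w
    induction w with
    | nil => rfl
    | cons hadj _ ih =>
      rw [deleteEdges_adj] at hadj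
      exact (hc' _ _ hadj.1 (by simpa using hadj.2)).trans ih
  exact hc (key _ _ w)

/-- A geodesic between vertices on different sides of an edge runs through that edge. -/
theorem IsTree.dist_eq_of_separating (hG : G.IsTree) {x y a b : V} (h : G.Adj x y)
    (ha : a ∉ G.halfTree x y) (hb : b ∈ G.halfTree x y) :
    G.dist a b = G.dist a x + 1 + G.dist y b := by
  apply le_antisymm
  · have h1 := hG.connected.dist_triangle (u := a) (v := x) (w := b)
    have h2 := hG.connected.dist_triangle (u := x) (v := y) (w := b)
    have h3 : G.dist x y = 1 := dist_eq_one_iff_adj.2 h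
    lia
  · obtain ⟨w, hw⟩ := hG.connected.exists_walk_length_eq_dist a b
    rw [← hw]
    clear hw
    induction w with
    | nil => exact absurd hb ha
    | cons hadj w ih =>
      rename_i a a' b
      rw [Walk.length_cons]
      by_cases ha' : a' ∈ G.halfTree x y
      · have h1 : s(a, a') = s(x, y) := by
          by_contra hne
          exact ha ((hG.mem_halfTree_iff_of_adj h hadj hne).2 ha')
        rcases Sym2.eq_iff.1 h1 with ⟨rfl, rfl⟩ | ⟨rfl, rfl⟩
        · have := dist_le w
          simp only [dist_self]
          lia
        · exact absurd (hG.target_mem_halfTree h) ha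
      · have h1 := ih ha' hb
        have h2 := hG.connected.dist_triangle (u := a) (v := a') (w := x)
        have h3 : G.dist a a' = 1 := dist_eq_one_iff_adj.2 hadj
        lia

/-- A half-tree whose boundary edge lies inside another half-tree, and which misses the boundary of
the latter, is contained in it. -/
theorem IsTree.halfTree_subset (hG : G.IsTree) {x y u v : V} (h : G.Adj x y) (h' : G.Adj u v)
    (hu : u ∈ G.halfTree x y) (hx : x ∉ G.halfTree u v) :
    G.halfTree u v ⊆ G.halfTree x y := by
  intro q
  contrapose!
  induction hn : G.dist q x generalizing q with
  | zero =>
    intro _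
    rwa [hG.connected.dist_eq_zero_iff.1 hn]
  | succ n ih =>
    intro hq
    have hqx : q ≠ x := by
      rintro rfl
      simp at hn
    obtain ⟨q', hqq', hlt⟩ := hG.connected.exists_adj_dist_lt hqx
    have h1 := dist_of_mem_halfTree hqq' hlt
    have hne : s(q, q') ≠ s(x, y) := by
      intro he
      rcases Sym2.eq_iff.1 he with ⟨rfl, rfl⟩ | ⟨rfl, rfl⟩
      · exact hqx rfl
      · exact hq (hG.target_mem_halfTree h)
    have hq' : q' ∉ G.halfTree x y := fun hh => hq ((hG.mem_halfTree_iff_of_adj h hqq' hne).2 hh)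
    have hne' : s(q, q') ≠ s(u, v) := by
      intro he
      rcases Sym2.eq_iff.1 he with ⟨rfl, rfl⟩ | ⟨rfl, rfl⟩
      · exact hq hu
      · exact hq' hu
    rw [hG.mem_halfTree_iff_of_adj h' hqq' hne']
    refine ih ?_ hq'
    rw [dist_comm (u := x), dist_comm (u := x)] at h1
    lia

end SimpleGraph

/-! ### Group actions on trees -/

namespace GTree

variable {G : Type u} [Group G] (T : GTree G)

/-- The half-tree of `T` cut off by the edge from `x` to `y`. -/
abbrev half (x y : T.X) : Set T.X := T.graph.halfTree x y

theorem adj_smul_iff (g : G) {x y : T.X} : T.graph.Adj (g • x) (g • y) ↔ T.graph.Adj x y := by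
  refine ⟨fun h => ?_, T.adj_smul g x y⟩
  simpa using T.adj_smul g⁻¹ _ _ h

/-- The automorphism of the tree given by a group element. -/
def smulIso (g : G) : T.graph ≃g T.graph where
  toEquiv := MulAction.toPerm g
  map_rel_iff' := T.adj_smul_iff g

theorem dist_smul (g : G) (x y : T.X) : T.graph.dist (g • x) (g • y) = T.graph.dist x y := by
  have key : ∀ (g : G) (x y : T.X), T.graph.dist (g • x) (g • y) ≤ T.graph.dist x y := by
    intro g x y
    obtain ⟨w, hw⟩ := T.isTree.connected.exists_walk_length_eq_dist x y
    have := SimpleGraph.dist_le (w.map (T.smulIso g).toHom)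
    rw [SimpleGraph.Walk.length_map] at this
    exact this.trans hw.le
  refine le_antisymm (key g x y) ?_
  simpa using key g⁻¹ (g • x) (g • y)

theorem smul_mem_half (g : G) (x y q : T.X) :
    g • q ∈ T.half (g • x) (g • y) ↔ q ∈ T.half x y := by
  simp [SimpleGraph.mem_halfTree, dist_smul]

theorem smul_mem_half_iff (g : G) (x y q : T.X) :
    g • q ∈ T.half x y ↔ q ∈ T.half (g⁻¹ • x) (g⁻¹ • y) := by
  rw [← T.smul_mem_half g (g⁻¹ • x) (g⁻¹ • y), smul_inv_smul, smul_inv_smul]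

/-- The tree `T` with the action pulled back along a homomorphism. -/
def comap {H : Type u} [Group H] (f : H →* G) : GTree H :=
  letI : MulAction H T.X := MulAction.compHom T.X f
  { X := T.X
    graph := T.graph
    isTree := T.isTree
    adj_smul := fun g => T.adj_smul (f g)
    no_inversion := fun g => T.no_inversion (f g) }

variable {T} in
theorem FiniteEdgeStabilizers.comap (hT : T.FiniteEdgeStabilizers) {H : Type u} [Group H]
    {f : H →* G} (hf : Function.Injective f) : (T.comap f).FiniteEdgeStabilizers := by
  intro x y hxy
  have := hT x y hxy
  let F : (T.comap f).edgeStabilizer x y → T.edgeStabilizer x y := fun h => ⟨f h.1, h.2⟩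
  refine Finite.of_injective F ?_
  intro a b hab
  exact Subtype.ext (hf (congrArg Subtype.val hab))

theorem comap_elliptic_iff {H : Type u} [Group H] (f : H →* G) (K : Subgroup H) :
    (T.comap f).Elliptic K ↔ T.Elliptic (K.map f) := by
  constructor
  · rintro ⟨x, hx⟩
    refine ⟨x, ?_⟩
    rintro _ ⟨k, hk, rfl⟩
    exact hx hk
  · rintro ⟨x, hx⟩
    exact ⟨x, fun k hk => hx (Subgroup.mem_map_of_mem f hk)⟩

variable {T} in
theorem Nontrivial.not_elliptic_top (hT : T.Nontrivial) : ¬ T.Elliptic ⊤ :=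
  fun ⟨x, hx⟩ => hT x (top_le_iff.1 hx)

variable {T} in
theorem nontrivial_of_not_elliptic_top (h : ¬ T.Elliptic ⊤) : T.Nontrivial :=
  fun x hx => h ⟨x, hx.ge⟩

/-- A subgroup with a finite orbit fixes a vertex: a centre of the orbit, since edges are not
inverted. -/
theorem elliptic_of_finite_orbit (K : Subgroup G) (p : T.X)
    (hfin : {q : T.X | ∃ k ∈ K, k • p = q}.Finite) : T.Elliptic K := by
  classical
  set O := {q : T.X | ∃ k ∈ K, k • p = q} with hO
  have hpO : p ∈ O := ⟨1, K.one_mem, one_smul _ _⟩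
  have hKO : ∀ k ∈ K, ∀ o ∈ O, k • o ∈ O := by
    rintro k hk _ ⟨l, hl, rfl⟩
    exact ⟨k * l, K.mul_mem hk hl, mul_smul _ _ _⟩
  have hex : ∃ n : ℕ, ∃ q, ∀ o ∈ O, T.graph.dist o q ≤ n := by
    obtain ⟨n, hn⟩ := (hfin.image (fun o => T.graph.dist o p)).bddAbove
    exact ⟨n, p, fun o ho => hn ⟨o, ho, rfl⟩⟩
  obtain ⟨q, hq⟩ := Nat.find_spec hex
  have hmin : ∀ m, m < Nat.find hex → ¬ ∃ q, ∀ o ∈ O, T.graph.dist o q ≤ m :=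
    fun m => Nat.find_min hex
  set n := Nat.find hex
  have hinv : ∀ k ∈ K, ∀ q, (∀ o ∈ O, T.graph.dist o q ≤ n) →
      ∀ o ∈ O, T.graph.dist o (k • q) ≤ n := by
    intro k hk q hq o ho
    rw [← T.dist_smul k⁻¹, inv_smul_smul]
    exact hq _ (hKO _ (K.inv_mem hk) _ ho)
  -- two distinct centres are adjacent, as a vertex strictly between them would be more central
  have hadj : ∀ q q', (∀ o ∈ O, T.graph.dist o q ≤ n) → (∀ o ∈ O, T.graph.dist o q' ≤ n) →
      q ≠ q' → T.graph.Adj q q' := by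
    intro q q' hq hq' hne
    obtain ⟨y, hy, hqy⟩ := T.isTree.connected.exists_adj_dist_lt hne
    have hd : T.graph.dist q q' = 1 := by
      by_contra hd
      have hd0 := T.isTree.connected.pos_dist_of_ne hne
      have hn0 : 0 < n := by
        by_contra h0
        have h1 := hq p hpO
        have h2 := hq' p hpO
        have h3 := T.isTree.connected.dist_triangle (u := q) (v := p) (w := q')
        rw [SimpleGraph.dist_comm (u := q) (v := p)] at h3
        lia
      refine hmin (n - 1) (by lia) ⟨y, fun o ho => ?_⟩
      have h1 := hq o ho
      have h2 := hq' o ho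
      by_cases hoy : o ∈ T.half q y
      · have := SimpleGraph.dist_of_mem_halfTree hy hoy
        lia
      · have h3 := T.isTree.dist_eq_of_separating hy hoy hqy
        have h4 := T.isTree.dist_eq_of_separating hy SimpleGraph.source_notMem_halfTree hqy
        have h5 := T.isTree.connected.dist_triangle (u := o) (v := q) (w := y)
        have h6 : T.graph.dist q y = 1 := SimpleGraph.dist_eq_one_iff_adj.2 hy
        rw [SimpleGraph.dist_self] at h4
        lia
    exact SimpleGraph.dist_eq_one_iff_adj.1 hd
  refine ⟨q, fun k hk => ?_⟩
  rw [MulAction.mem_stabilizer_iff]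
  by_contra hne
  have h1 := hadj q (k • q) hq (hinv k hk q hq) (Ne.symm hne)
  have hqk := hinv k hk _ (hinv k hk q hq)
  have hne2 : k • k • q ≠ q := fun h => T.no_inversion k q (k • q) h1 ⟨rfl, h⟩
  have h2 := hadj q _ hq hqk hne2.symm
  have h3 := T.adj_smul k _ _ h1
  -- `q`, `kq`, `k²q` would form a triangle
  have hd := T.isTree.dist_ne_of_adj q h3
  rw [SimpleGraph.dist_eq_one_iff_adj.2 h1, SimpleGraph.dist_eq_one_iff_adj.2 h2] at hd
  exact hd rfl

/-- For each group element `z` there is a vertex `p`, one of minimal displacement, such that each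
edge separating `p` from `z • p` separates the two halves of the orbit of `p` under `z`. -/
theorem exists_minimal_displacement (z : G) : ∃ p : T.X, ∀ x y, T.graph.Adj x y →
    p ∉ T.half x y → z • p ∈ T.half x y → ∀ n : ℤ, z ^ n • p ∈ T.half x y ↔ 1 ≤ n := by
  classical
  have : Nonempty T.X := T.isTree.connected.nonempty
  have hex : ∃ n : ℕ, ∃ p : T.X, T.graph.dist p (z • p) = n :=
    ⟨_, Classical.arbitrary _, rfl⟩
  obtain ⟨p, hp⟩ := Nat.find_spec hex
  have hmin : ∀ q : T.X, Nat.find hex ≤ T.graph.dist q (z • q) :=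
    fun q => Nat.find_min' hex ⟨q, rfl⟩
  set L := Nat.find hex
  refine ⟨p, fun x y hxy hpx hpy => ?_⟩
  -- `x` lies on the geodesic from `p` to `z • p`, and so has minimal displacement as well
  have h1 := T.isTree.dist_eq_of_separating hxy hpx hpy
  have h2 := hmin x
  have h3 : T.graph.dist y (z • x) ≤ T.graph.dist y (z • p) + T.graph.dist p x := by
    have := T.isTree.connected.dist_triangle (u := y) (v := z • p) (w := z • x)
    rwa [T.dist_smul] at this
  have hzx : z • x ∈ T.half x y := by
    rw [SimpleGraph.mem_halfTree, SimpleGraph.dist_comm, SimpleGraph.dist_comm (v := x)]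
    lia
  have hne : s(x, y) ≠ s(z • x, z • y) := by
    intro he
    rcases Sym2.eq_iff.1 he with ⟨h, _⟩ | ⟨h, h'⟩
    · rw [← h] at hzx
      exact SimpleGraph.source_notMem_halfTree hzx
    · exact T.no_inversion z x y hxy ⟨h'.symm, h.symm⟩
  have hxz : x ∉ T.half (z • x) (z • y) := by
    intro hx
    have hy := (T.isTree.mem_halfTree_iff_of_adj (T.adj_smul z _ _ hxy) hxy hne).1 hx
    have h4 := SimpleGraph.dist_of_mem_halfTree (T.adj_smul z _ _ hxy) hy
    have h5 := hmin y
    have h6 := SimpleGraph.dist_of_mem_halfTree hxy hzx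
    rw [SimpleGraph.dist_comm] at h6
    rw [SimpleGraph.dist_comm (u := z • x) (v := y)] at h6
    have h7 := T.isTree.connected.dist_triangle (u := x) (v := z • p) (w := z • x)
    have h8 := T.isTree.connected.dist_triangle (u := x) (v := y) (w := z • p)
    rw [T.dist_smul] at h7
    have h9 : T.graph.dist x y = 1 := SimpleGraph.dist_eq_one_iff_adj.2 hxy
    lia
  have hsub : T.half (z • x) (z • y) ⊆ T.half x y :=
    T.isTree.halfTree_subset hxy (T.adj_smul z _ _ hxy) hzx hxz
  have hstep : ∀ n : ℤ, z ^ n • p ∈ T.half x y → z ^ (n + 1) • p ∈ T.half x y := by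
    intro n hn
    apply hsub
    rw [add_comm, zpow_add, zpow_one, mul_smul]
    exact (T.smul_mem_half z _ _ _).2 hn
  intro n
  constructor
  · intro hn
    by_contra hn1
    obtain ⟨k, hk⟩ : ∃ k : ℕ, n + k = 0 := ⟨(-n).toNat, by lia⟩
    have : ∀ k : ℕ, z ^ (n + k) • p ∈ T.half x y := by
      intro k
      induction k with
      | zero => simpa using hn
      | succ k ih =>
        have := hstep _ ih
        rwa [add_assoc] at this
    have h0 := this k
    rw [hk, zpow_zero, one_smul] at h0
    exact hpx h0
  · intro hn
    induction n, hn using Int.leInduction with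
    | base => simpa using hpy
    | succ n _ ih => exact hstep n ih

end GTree

/-! ### Two-ended groups -/

theorem Subgroup.exists_finite_mul_eq {G : Type*} [Group G] (K : Subgroup G) [K.FiniteIndex] :
    ∃ F : Set G, F.Finite ∧ ∀ g : G, ∃ k ∈ K, ∃ j ∈ F, g = k * j := by
  refine ⟨Set.range fun q : G ⧸ K => (q.out)⁻¹, Set.finite_range _, fun g => ?_⟩
  obtain ⟨h, hh⟩ := QuotientGroup.mk_out_eq_mul K g⁻¹
  refine ⟨h, h.2, _, ⟨(g⁻¹ : G), rfl⟩, ?_⟩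
  simp only [hh]
  group

theorem IsTwoEnded.infinite {G : Type u} [Group G] (hG : IsTwoEnded G) : Infinite G := by
  obtain ⟨z, hz, _⟩ := hG
  by_contra h
  rw [not_infinite_iff_finite] at h
  exact hz (isOfFinOrder_of_finite z)

/-- An infinite subgroup of a two-ended group contains a power of a given infinite cyclic subgroup
of finite index, and so has finite index. -/
theorem IsTwoEnded.finiteIndex_of_infinite {G : Type u} [Group G] (hG : IsTwoEnded G)
    (K : Subgroup G) [Infinite K] : K.FiniteIndex := by
  obtain ⟨z, hz, hfin⟩ := hG
  have h1 : ((Subgroup.zpowers z).subgroupOf K).FiniteIndex := inferInstance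
  have h2 : Infinite ((Subgroup.zpowers z).subgroupOf K) := by
    by_contra h
    rw [not_infinite_iff_finite] at h
    exact not_finite_iff_infinite.2 ‹Infinite K›
      ((Subgroup.finite_iff_finite_and_finiteIndex ((Subgroup.zpowers z).subgroupOf K)).2 ⟨h, h1⟩)
  obtain ⟨⟨⟨k, hk⟩, hk'⟩, hne⟩ := exists_ne (1 : (Subgroup.zpowers z).subgroupOf K)
  obtain ⟨m, rfl⟩ := Subgroup.mem_zpowers_iff.1 (Subgroup.mem_subgroupOf.1 hk')
  have hm : m ≠ 0 := by
    rintro rfl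
    exact hne (by simp)
  obtain ⟨F, hF, hFz⟩ := (Subgroup.zpowers z).exists_finite_mul_eq
  have hfin : Finite (G ⧸ K) := by
    -- the cosets of the elements `j⁻¹ z ^ r`, with `j ∈ F` and `0 ≤ r < |m|`, exhaust `G`
    let S : Set (G ⧸ K) := (fun x : G × ℤ => ((x.1⁻¹ * z ^ x.2 : G) : G ⧸ K)) ''
      (F ×ˢ Set.Ico 0 |m|)
    have hS : S.Finite := (hF.prod (Set.finite_Ico 0 |m|)).image _
    refine Set.finite_univ_iff.1 (hS.subset ?_)
    intro q _
    obtain ⟨g, rfl⟩ := QuotientGroup.mk_surjective q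
    obtain ⟨l, hl, j, hj, hg⟩ := hFz g⁻¹
    obtain ⟨n, rfl⟩ := Subgroup.mem_zpowers_iff.1 hl
    refine ⟨(j, (-n) % m), ⟨hj, Int.emod_nonneg _ hm, Int.emod_lt_abs _ hm⟩, ?_⟩
    rw [QuotientGroup.eq]
    have h3 : g = j⁻¹ * z ^ (-n) := by
      rw [← inv_inv g, hg]
      group
    have h4 : (z ^ m) ^ ((-n) / m) ∈ K := K.zpow_mem hk _
    convert h4 using 1
    rw [h3, ← zpow_mul]
    have h5 : m * (-n / m) = (-n) - (-n) % m := by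
      have := Int.mul_ediv_add_emod (-n) m
      linarith
    rw [h5, zpow_sub]
    group
  exact Subgroup.finiteIndex_of_finite_quotient

theorem IsTwoEnded.of_equiv {G H : Type u} [Group G] [Group H] (f : G ≃* H) (hG : IsTwoEnded G) :
    IsTwoEnded H := by
  obtain ⟨z, hz, hfin⟩ := hG
  refine ⟨f z, fun h => hz ?_, ?_⟩
  · exact (Function.Injective.isOfFinOrder_iff (f := f.toMonoidHom) f.injective).1 h
  · have h1 : (Subgroup.zpowers z).map f.toMonoidHom = Subgroup.zpowers (f z) := by
      rw [MonoidHom.map_zpowers]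
      rfl
    rw [← h1, Subgroup.finiteIndex_iff]
    rw [show f.toMonoidHom = (f : G →* H) from rfl, Subgroup.index_map_equiv]
    exact hfin.index_ne_zero

/-! ### Axes -/

namespace GTree

variable {G : Type u} [Group G] (T : GTree G) {C : Type u} [Group C]

/-- The edge `xy` lies on the axis of the group `C`, acting on the tree `T` through `f`: on both
sides of the edge there are infinitely many points (counted with multiplicity) of each orbit of `C`.
For a two-ended group without fixed vertex these are the edges of the invariant line. -/
def OnAxis (f : C →* G) (x y : T.X) : Prop :=
  ∀ p : T.X, {c : C | f c • p ∈ T.half x y}.Infinite ∧ {c : C | f c • p ∉ T.half x y}.Infinite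

theorem smul_onAxis_iff (f : C →* G) (g : G) (x y : T.X) :
    T.OnAxis f (g • x) (g • y) ↔ T.OnAxis ((MulAut.conj g⁻¹).toMonoidHom.comp f) x y := by
  have key : ∀ (c : C) (p : T.X), f c • g • p ∈ T.half (g • x) (g • y) ↔
      ((MulAut.conj g⁻¹).toMonoidHom.comp f) c • p ∈ T.half x y := by
    intro c p
    rw [← T.smul_mem_half g⁻¹, inv_smul_smul, inv_smul_smul]
    simp [mul_smul]
  constructor
  · intro h p
    simpa only [key] using h (g • p)
  · intro h p
    have := h (g⁻¹ • p)
    simp only [← key, smul_inv_smul] at this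
    exact this

variable {T}

theorem FiniteEdgeStabilizers.finite_transporter (hT : T.FiniteEdgeStabilizers) {x y : T.X}
    (h : T.graph.Adj x y) (u v : T.X) : {g : G | g • x = u ∧ g • y = v}.Finite := by
  by_cases hne : {g : G | g • x = u ∧ g • y = v}.Nonempty
  · obtain ⟨g₀, h1, h2⟩ := hne
    have := hT x y h
    refine (Set.toFinite ((fun g : G => g₀ * g) '' (T.edgeStabilizer x y : Set G))).subset ?_
    rintro g ⟨h3, h4⟩
    refine ⟨g₀⁻¹ * g, ?_, by simp⟩
    constructor
    · change (g₀⁻¹ * g) • x = x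
      rw [mul_smul, h3, ← h1, inv_smul_smul]
    · change (g₀⁻¹ * g) • y = y
      rw [mul_smul, h4, ← h2, inv_smul_smul]
  · rw [Set.not_nonempty_iff_eq_empty] at hne
    rw [hne]
    exact Set.finite_empty

/-- Orbit points of two vertices lie on the same side of an edge, with finitely many exceptions. -/
theorem FiniteEdgeStabilizers.finite_separated (hT : T.FiniteEdgeStabilizers) {f : C →* G}
    (hf : Function.Injective f) {x y : T.X} (h : T.graph.Adj x y) (p p' : T.X) :
    {c : C | ¬ (f c • p ∈ T.half x y ↔ f c • p' ∈ T.half x y)}.Finite := by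
  have h1 : {g : G | ¬ (g • p ∈ T.half x y ↔ g • p' ∈ T.half x y)}.Finite := by
    have h2 := (T.isTree.finite_separating p p').biUnion
      (t := fun e => Inv.inv '' {g : G | g • x = e.1 ∧ g • y = e.2})
      fun e _ => (hT.finite_transporter h e.1 e.2).image _
    refine h2.subset ?_
    intro g hg
    rw [Set.mem_ofPred_eq, T.smul_mem_half_iff, T.smul_mem_half_iff] at hg
    simp only [Set.mem_iUnion]
    exact ⟨(g⁻¹ • x, g⁻¹ • y), ⟨T.adj_smul _ _ _ h, hg⟩, g⁻¹, ⟨rfl, rfl⟩, inv_inv g⟩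
  exact h1.preimage hf.injOn

theorem FiniteEdgeStabilizers.infinite_half_iff (hT : T.FiniteEdgeStabilizers) {f : C →* G}
    (hf : Function.Injective f) {x y : T.X} (h : T.graph.Adj x y) (p p' : T.X) :
    {c : C | f c • p ∈ T.half x y}.Infinite ↔ {c : C | f c • p' ∈ T.half x y}.Infinite := by
  have key : ∀ p p' : T.X, {c : C | f c • p ∈ T.half x y}.Finite →
      {c : C | f c • p' ∈ T.half x y}.Finite := by
    intro p p' hp
    refine (hp.union (hT.finite_separated hf h p p')).subset ?_
    intro c hc
    simp only [Set.mem_union, Set.mem_ofPred_eq] at hc ⊢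
    tauto
  exact not_congr ⟨key _ _, key _ _⟩

theorem compl_half_infinite_iff (f : C →* G) {x y : T.X} (h : T.graph.Adj x y) (p : T.X) :
    {c : C | f c • p ∉ T.half x y}.Infinite ↔ {c : C | f c • p ∈ T.half y x}.Infinite := by
  simp only [half, T.isTree.mem_halfTree_swap h]

theorem FiniteEdgeStabilizers.onAxis_of_exists (hT : T.FiniteEdgeStabilizers) {f : C →* G}
    (hf : Function.Injective f) {x y : T.X} (h : T.graph.Adj x y) (p : T.X)
    (h1 : {c : C | f c • p ∈ T.half x y}.Infinite)
    (h2 : {c : C | f c • p ∉ T.half x y}.Infinite) : T.OnAxis f x y := by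
  intro q
  rw [compl_half_infinite_iff f h] at h2 ⊢
  exact ⟨(hT.infinite_half_iff hf h p q).1 h1, (hT.infinite_half_iff hf h.symm p q).1 h2⟩

theorem OnAxis.symm {f : C →* G} {x y : T.X} (h : T.graph.Adj x y) (hxy : T.OnAxis f x y) :
    T.OnAxis f y x := by
  intro p
  rw [compl_half_infinite_iff f h.symm, ← compl_half_infinite_iff f h]
  exact (hxy p).symm

/-- The axis of a subgroup of finite index contains the axis of the group. -/
theorem FiniteEdgeStabilizers.onAxis_finiteIndex (hT : T.FiniteEdgeStabilizers) {f : C →* G}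
    (hf : Function.Injective f) {x y : T.X} (h : T.graph.Adj x y) (hxy : T.OnAxis f x y)
    (K : Subgroup C) [K.FiniteIndex] : T.OnAxis (f.comp K.subtype) x y := by
  have hK : Function.Injective (f.comp K.subtype) := hf.comp K.subtype_injective
  obtain ⟨F, hF, hFK⟩ := K.exists_finite_mul_eq
  have key : ∀ x y, T.graph.Adj x y → ∀ p : T.X, {c : C | f c • p ∈ T.half x y}.Infinite →
      {c : K | (f.comp K.subtype) c • p ∈ T.half x y}.Infinite := by
    intro x y h p h1
    by_contra h2
    have h3 : ∀ j ∈ F, {c : K | (f.comp K.subtype) c • f j • p ∈ T.half x y}.Finite := by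
      intro j _
      by_contra h4
      exact h2 ((hT.infinite_half_iff hK h _ _).1 h4)
    refine h1 ((hF.biUnion fun j hj => (h3 j hj).image fun c : K => (c : C) * j).subset ?_)
    intro c hc
    obtain ⟨k, hk, j, hj, rfl⟩ := hFK c
    simp only [Set.mem_iUnion]
    refine ⟨j, hj, ⟨k, hk⟩, ?_, rfl⟩
    simpa [mul_smul] using hc
  intro p
  refine ⟨key x y h p (hxy p).1, ?_⟩
  rw [compl_half_infinite_iff _ h]
  exact key y x h.symm p ((compl_half_infinite_iff f h p).1 (hxy p).2)

theorem FiniteEdgeStabilizers.onAxis_of_subgroup (hT : T.FiniteEdgeStabilizers) {f : C →* G}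
    (hf : Function.Injective f) {x y : T.X} (h : T.graph.Adj x y)
    (K : Subgroup C) (hxy : T.OnAxis (f.comp K.subtype) x y) : T.OnAxis f x y := by
  obtain ⟨p⟩ := T.isTree.connected.nonempty
  obtain ⟨h1, h2⟩ := hxy p
  refine hT.onAxis_of_exists hf h p ?_ ?_
  · exact (h1.image K.subtype_injective.injOn).mono (by rintro _ ⟨c, hc, rfl⟩; exact hc)
  · exact (h2.image K.subtype_injective.injOn).mono (by rintro _ ⟨c, hc, rfl⟩; exact hc)

/-- For a suitable generator `z` of a subgroup of finite index in the two-ended group `C` and a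
suitable vertex `p`, all edges between `p` and `z • p` lie on the axis of `C`. -/
theorem FiniteEdgeStabilizers.exists_onAxis_of_separating (hT : T.FiniteEdgeStabilizers)
    {f : C →* G} (hf : Function.Injective f) {z : C} (hz : ¬ IsOfFinOrder z) :
    ∃ p : T.X, ∀ x y, T.graph.Adj x y →
      ¬ (p ∈ T.half x y ↔ f z • p ∈ T.half x y) → T.OnAxis f x y := by
  obtain ⟨p, hp⟩ := T.exists_minimal_displacement (f z)
  have hinj : Function.Injective fun n : ℤ => z ^ n := injective_zpow_iff_not_isOfFinOrder.2 hz
  have key : ∀ x y, T.graph.Adj x y → p ∉ T.half x y → f z • p ∈ T.half x y →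
      T.OnAxis f x y := by
    intro x y h h1 h2
    have h3 := hp x y h h1 h2
    refine hT.onAxis_of_exists hf h p ?_ ?_
    · refine ((Set.Ici_infinite (1 : ℤ)).image hinj.injOn).mono ?_
      rintro _ ⟨n, hn, rfl⟩
      simpa using (h3 n).2 hn
    · refine ((Set.Iic_infinite (0 : ℤ)).image hinj.injOn).mono ?_
      rintro _ ⟨n, hn, rfl⟩
      have hn' : ¬ 1 ≤ n := by
        have : n ≤ 0 := hn
        lia
      simpa [h3 n] using hn'
  refine ⟨p, fun x y h hsep => ?_⟩
  by_cases h1 : p ∈ T.half x y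
  · have h2 : f z • p ∉ T.half x y := fun h2 => hsep ⟨fun _ => h2, fun _ => h1⟩
    exact (key y x h.symm (by rw [half, T.isTree.mem_halfTree_swap h]; exact not_not.2 h1)
      ((T.isTree.mem_halfTree_swap h _).2 h2)).symm h.symm
  · have h2 : f z • p ∈ T.half x y := by
      by_contra h2
      exact hsep ⟨fun h => absurd h h1, fun h => absurd h h2⟩
    exact key x y h h1 h2

theorem elliptic_of_finiteIndex (T : GTree G) (f : C →* G) (K : Subgroup C) [K.FiniteIndex]
    {p : T.X} (hp : ∀ k ∈ K, f k • p = p) : T.Elliptic f.range := by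
  refine T.elliptic_of_finite_orbit _ p ?_
  obtain ⟨F, hF, hFK⟩ := K.exists_finite_mul_eq
  refine (hF.image fun j => f j⁻¹ • p).subset ?_
  rintro _ ⟨_, ⟨c, rfl⟩, rfl⟩
  obtain ⟨k, hk, j, hj, hc⟩ := hFK c⁻¹
  refine ⟨j, hj, ?_⟩
  have : c = j⁻¹ * k⁻¹ := by rw [← inv_inv c, hc, mul_inv_rev]
  simp only [this, map_mul, mul_smul, hp _ (K.inv_mem hk)]

/-- If a generator of a subgroup of finite index fixes a vertex, then the group does. -/
theorem elliptic_of_zpowers (T : GTree G) (f : C →* G) (z : C)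
    [(Subgroup.zpowers z).FiniteIndex] {p : T.X} (hp : f z • p = p) : T.Elliptic f.range := by
  refine T.elliptic_of_finiteIndex f (Subgroup.zpowers z) (p := p) ?_
  intro k hk
  obtain ⟨n, rfl⟩ := Subgroup.mem_zpowers_iff.1 hk
  have h1 : f z ∈ MulAction.stabilizer G p := hp
  rw [map_zpow]
  exact (MulAction.stabilizer G p).zpow_mem h1 n

/-- A two-ended group acting without a fixed vertex has an axis. -/
theorem FiniteEdgeStabilizers.exists_onAxis (hT : T.FiniteEdgeStabilizers) (hC : IsTwoEnded C)
    {f : C →* G} (hf : Function.Injective f) (hell : ¬ T.Elliptic f.range) :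
    ∃ x y, T.graph.Adj x y ∧ T.OnAxis f x y := by
  obtain ⟨z, hz, hfin⟩ := hC
  obtain ⟨p, hp⟩ := hT.exists_onAxis_of_separating hf hz
  have hne : p ≠ f z • p := fun h => hell (T.elliptic_of_zpowers f z h.symm)
  obtain ⟨y, hy, hlt⟩ := T.isTree.connected.exists_adj_dist_lt hne
  exact ⟨p, y, hy, hp p y hy fun h => SimpleGraph.source_notMem_halfTree (h.2 hlt)⟩

/-- A two-ended group has finitely many orbits of edges on its axis. -/
theorem FiniteEdgeStabilizers.finite_onAxis_orbits (hT : T.FiniteEdgeStabilizers)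
    (hC : IsTwoEnded C) {f : C →* G} (hf : Function.Injective f) :
    ∃ Φ : Set (T.X × T.X), Φ.Finite ∧ ∀ x y, T.graph.Adj x y → T.OnAxis f x y →
      ∃ c : C, (f c • x, f c • y) ∈ Φ := by
  obtain ⟨z, hz, hfin⟩ := hC
  obtain ⟨p⟩ := T.isTree.connected.nonempty
  refine ⟨_, T.isTree.finite_separating p (f z • p), fun x y h hxy => ?_⟩
  by_contra hno
  have hno : ∀ c : C, _ := fun c hc => hno ⟨c, hc⟩
  have hstep : ∀ n : ℤ, f (z ^ n) • p ∈ T.half x y ↔ f (z ^ (n + 1)) • p ∈ T.half x y := by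
    intro n
    by_contra hn
    refine hno (z ^ n)⁻¹ ⟨T.adj_smul _ _ _ h, ?_⟩
    rwa [zpow_add, zpow_one, map_mul, mul_smul, T.smul_mem_half_iff, T.smul_mem_half_iff,
      ← map_inv] at hn
  have hall : ∀ n : ℤ, f (z ^ n) • p ∈ T.half x y ↔ p ∈ T.half x y := by
    intro n
    induction n with
    | zero => simp
    | succ n ih => rw [← hstep, ih]
    | pred n ih =>
      rw [hstep, sub_add_cancel, ih]
  obtain ⟨h1, h2⟩ := hT.onAxis_finiteIndex hf h hxy (Subgroup.zpowers z) p
  obtain ⟨⟨c, hc⟩, h1⟩ := h1.nonempty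
  obtain ⟨⟨d, hd⟩, h2⟩ := h2.nonempty
  obtain ⟨n, rfl⟩ := Subgroup.mem_zpowers_iff.1 hc
  obtain ⟨m, rfl⟩ := Subgroup.mem_zpowers_iff.1 hd
  exact h2 ((hall m).2 ((hall n).1 h1))

end GTree

/-! ### Trees of lines -/

namespace GTree

variable {G : Type u} [Group G] {T : GTree G}

theorem OnAxis.infinite_half {C : Type u} [Group C] {f : C →* G} {a b u v : T.X}
    (hab : T.graph.Adj a b) (huv : T.graph.Adj u v) (h : T.OnAxis f a b)
    (ha : a ∈ T.half u v) (hb : b ∈ T.half u v) (p : T.X) :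
    {c : C | f c • p ∈ T.half u v}.Infinite := by
  by_cases hu : u ∈ T.half a b
  · have hu' : u ∉ T.half b a := by
      rw [half, T.isTree.mem_halfTree_swap hab]
      exact not_not.2 hu
    have hsub := T.isTree.halfTree_subset huv hab.symm hb hu'
    exact (h.symm hab p).1.mono fun c hc => hsub hc
  · have hsub := T.isTree.halfTree_subset huv hab ha hu
    exact (h p).1.mono fun c hc => hsub hc

theorem OnAxis.of_sym2_eq {C : Type u} [Group C] {f : C →* G} {a b u v : T.X}
    (hab : T.graph.Adj a b) (h : T.OnAxis f a b) (he : s(a, b) = s(u, v)) : T.OnAxis f u v := by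
  rcases Sym2.eq_iff.1 he with ⟨rfl, rfl⟩ | ⟨rfl, rfl⟩
  · exact h
  · exact h.symm hab

/-- Axes are convex. -/
theorem FiniteEdgeStabilizers.onAxis_convex (hT : T.FiniteEdgeStabilizers) {C : Type u} [Group C]
    {f : C →* G} (hf : Function.Injective f) {a b a' b' u v q q' : T.X} (hab : T.graph.Adj a b)
    (hab' : T.graph.Adj a' b') (huv : T.graph.Adj u v) (h : T.OnAxis f a b)
    (h' : T.OnAxis f a' b') (hq : q = a ∨ q = b) (hq' : q' = a' ∨ q' = b')
    (hsep : ¬ (q ∈ T.half u v ↔ q' ∈ T.half u v)) : T.OnAxis f u v := by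
  by_cases h1 : s(a, b) = s(u, v)
  · exact h.of_sym2_eq hab h1
  by_cases h2 : s(a', b') = s(u, v)
  · exact h'.of_sym2_eq hab' h2
  have h3 := T.isTree.mem_halfTree_iff_of_adj huv hab h1
  have h4 := T.isTree.mem_halfTree_iff_of_adj huv hab' h2
  obtain ⟨p⟩ := T.isTree.connected.nonempty
  refine hT.onAxis_of_exists hf huv p ?_ ?_
  · by_cases h5 : a ∈ T.half u v
    · exact h.infinite_half hab huv h5 (h3.1 h5) p
    · have h6 : a' ∈ T.half u v := by
        rcases hq with rfl | rfl <;> rcases hq' with rfl | rfl <;> tauto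
      exact h'.infinite_half hab' huv h6 (h4.1 h6) p
  · rw [compl_half_infinite_iff f huv]
    by_cases h5 : a ∈ T.half u v
    · have h6 : a' ∉ T.half u v := by
        rcases hq with rfl | rfl <;> rcases hq' with rfl | rfl <;> tauto
      exact h'.infinite_half hab' huv.symm ((T.isTree.mem_halfTree_swap huv _).2 h6)
        ((T.isTree.mem_halfTree_swap huv _).2 fun h => h6 (h4.2 h)) p
    · exact h.infinite_half hab huv.symm ((T.isTree.mem_halfTree_swap huv _).2 h5)
        ((T.isTree.mem_halfTree_swap huv _).2 fun h => h5 (h3.2 h)) p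

theorem onAxis_smul_of_mem {C : Subgroup G} {x y : T.X} (h : T.OnAxis C.subtype x y) {g : G}
    (hg : g ∈ C) : T.OnAxis C.subtype (g • x) (g • y) := by
  have hinj : Function.Injective fun c : C => (⟨g, hg⟩ : C) * c := mul_right_injective _
  intro p
  obtain ⟨h1, h2⟩ := h p
  constructor
  · refine (h1.image hinj.injOn).mono ?_
    rintro _ ⟨c, hc, rfl⟩
    simpa [mul_smul, T.smul_mem_half] using hc
  · refine (h2.image hinj.injOn).mono ?_
    rintro _ ⟨c, hc, rfl⟩
    simpa [mul_smul, T.smul_mem_half] using hc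

variable (T)

/-- The position of the vertex `q` with respect to the translates of the edge `xy`. Two vertices
have the same position when they are identified in the tree obtained from `T` by collapsing all
edges outside the orbit of `xy`. -/
def position (x y q : T.X) : G → Prop := fun g => q ∈ T.half (g • x) (g • y)

theorem position_smul (x y q : T.X) (k g : G) :
    T.position x y (k • q) g = T.position x y q (k⁻¹ * g) := by
  simp only [position, T.smul_mem_half_iff, mul_smul]

/-- The set of vertices of the tree obtained from `T` by collapsing all edges outside the orbit of
`xy`. -/
abbrev Collapsed (x y : T.X) : Type u := Set.range (T.position x y)

/-- The vertex of the collapsed tree that is represented by a vertex of `T`. -/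
def toCollapsed (x y q : T.X) : T.Collapsed x y := ⟨T.position x y q, q, rfl⟩

instance (x y : T.X) : MulAction G (T.Collapsed x y) where
  smul k s := ⟨fun g => s.1 (k⁻¹ * g), by
    obtain ⟨q, hq⟩ := s.2
    exact ⟨k • q, by funext g; rw [position_smul, hq]⟩⟩
  one_smul s := Subtype.ext (funext fun g => by
    change s.1 (1⁻¹ * g) = s.1 g
    simp)
  mul_smul k l s := Subtype.ext (funext fun g => by
    change s.1 ((k * l)⁻¹ * g) = s.1 (l⁻¹ * (k⁻¹ * g))
    simp [mul_assoc])

theorem smul_toCollapsed (x y q : T.X) (k : G) :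
    k • T.toCollapsed x y q = T.toCollapsed x y (k • q) :=
  Subtype.ext (funext fun g => (T.position_smul x y q k g).symm)

/-- The incidence between vertices of the collapsed tree and cosets of `C`: the coset of `g` is
incident to the ends of the edge `g • xy`. -/
def LineIncident (x y : T.X) (C : Subgroup G) (s : T.Collapsed x y) (B : G ⧸ C) : Prop :=
  ∃ (g : G) (q : T.X), (q = g • x ∨ q = g • y) ∧ s = T.toCollapsed x y q ∧ B = g

theorem LineIncident.smul {x y : T.X} {C : Subgroup G} {s : T.Collapsed x y} {B : G ⧸ C}
    (h : T.LineIncident x y C s B) (k : G) : T.LineIncident x y C (k • s) (k • B) := by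
  obtain ⟨g, q, hq, rfl, rfl⟩ := h
  refine ⟨k * g, k • q, ?_, T.smul_toCollapsed x y q k, rfl⟩
  rcases hq with rfl | rfl
  · exact Or.inl (mul_smul _ _ _).symm
  · exact Or.inr (mul_smul _ _ _).symm

variable {T}

/-- Vertices on the line of the coset `B` are separated only by edges of this line. -/
theorem FiniteEdgeStabilizers.lineIncident_separated (hT : T.FiniteEdgeStabilizers) {x y : T.X}
    (hxy : T.graph.Adj x y) {C : Subgroup G} (haxis : T.OnAxis C.subtype x y)
    (huniq : ∀ g : G, T.OnAxis C.subtype (g • x) (g • y) → g ∈ C)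
    {s s' : T.Collapsed x y} {B : G ⧸ C} (h : T.LineIncident x y C s B)
    (h' : T.LineIncident x y C s' B) {k : G} (hk : ¬ (s.1 k ↔ s'.1 k)) : (k : G ⧸ C) = B := by
  obtain ⟨g, q, hq, rfl, rfl⟩ := h
  obtain ⟨g', q', hq', rfl, hg'⟩ := h'
  rw [QuotientGroup.eq] at hg'
  have hadj := fun g : G => T.adj_smul g _ _ hxy
  symm
  rw [QuotientGroup.eq]
  apply huniq
  refine hT.onAxis_convex C.subtype_injective (q := g⁻¹ • q) (q' := g⁻¹ • q') hxy
    (hadj (g⁻¹ * g')) (hadj _) haxis (onAxis_smul_of_mem haxis hg') ?_ ?_ ?_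
  · rcases hq with rfl | rfl <;> simp
  · rcases hq' with rfl | rfl <;> simp [mul_smul]
  · rw [mul_smul, mul_smul, T.smul_mem_half, T.smul_mem_half]
    exact hk

/-- The graph obtained from the collapsed tree by replacing each line, a translate of the axis of
`C`, by a star, whose centre is a coset of `C`. -/
def lineGraph (x y : T.X) (C : Subgroup G) : SimpleGraph (T.Collapsed x y ⊕ G ⧸ C) where
  Adj
    | .inl s, .inr B => T.LineIncident x y C s B
    | .inr B, .inl s => T.LineIncident x y C s B
    | _, _ => False
  symm.symm a b h := by
    cases a <;> cases b <;> exact h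
  loopless.irrefl a h := by
    cases a <;> exact h

/-- The side of the edge between `s` and `B` in the tree of lines that contains `s`. -/
def lineCut {x y : T.X} {C : Subgroup G} (s : T.Collapsed x y) (B : G ⧸ C) :
    T.Collapsed x y ⊕ G ⧸ C → Prop
  | .inl s' => ∀ k : G, (k : G ⧸ C) = B → (s.1 k ↔ s'.1 k)
  | .inr B' => B' ≠ B ∧ ∃ s', T.LineIncident x y C s' B' ∧
      ∀ k : G, (k : G ⧸ C) = B → (s.1 k ↔ s'.1 k)

theorem FiniteEdgeStabilizers.lineGraph_isTree (hT : T.FiniteEdgeStabilizers) {x y : T.X}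
    (hxy : T.graph.Adj x y) {C : Subgroup G} (haxis : T.OnAxis C.subtype x y)
    (huniq : ∀ g : G, T.OnAxis C.subtype (g • x) (g • y) → g ∈ C) :
    (lineGraph x y C).IsTree := by
  have hsep := @FiniteEdgeStabilizers.lineIncident_separated G _ T hT x y hxy C haxis huniq
  refine ⟨?_, ?_⟩
  · -- connectedness: move along the edges of `T`
    have hinl : ∀ q q' : T.X, (lineGraph x y C).Reachable (.inl (T.toCollapsed x y q))
        (.inl (T.toCollapsed x y q')) := by
      intro q q'
      obtain ⟨w⟩ := T.isTree.connected q q'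
      induction w with
      | nil => exact SimpleGraph.Reachable.refl _
      | cons hadj w ih =>
        rename_i q q' q''
        refine SimpleGraph.Reachable.trans ?_ ih
        by_cases he : ∃ g : G, s(q, q') = s(g • x, g • y)
        · obtain ⟨g, hg⟩ := he
          have h1 : (lineGraph x y C).Adj (.inl (T.toCollapsed x y q)) (.inr g) := by
            refine ⟨g, q, ?_, rfl, rfl⟩
            rcases Sym2.eq_iff.1 hg with ⟨rfl, rfl⟩ | ⟨rfl, rfl⟩ <;> simp
          have h2 : (lineGraph x y C).Adj (.inl (T.toCollapsed x y q')) (.inr g) := by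
            refine ⟨g, q', ?_, rfl, rfl⟩
            rcases Sym2.eq_iff.1 hg with ⟨rfl, rfl⟩ | ⟨rfl, rfl⟩ <;> simp
          exact h1.reachable.trans h2.symm.reachable
        · push Not at he
          have : T.toCollapsed x y q = T.toCollapsed x y q' :=
            Subtype.ext (funext fun g => propext
              (T.isTree.mem_halfTree_iff_of_adj (T.adj_smul g _ _ hxy) hadj (he g)))
          rw [this]
    have hbase : ∀ a, (lineGraph x y C).Reachable (.inl (T.toCollapsed x y x)) a := by
      rintro (⟨_, q, rfl⟩ | B)
      · exact hinl _ _
      · obtain ⟨g, rfl⟩ := QuotientGroup.mk_surjective B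
        have h1 : (lineGraph x y C).Adj (.inl (T.toCollapsed x y (g • x))) (.inr g) :=
          ⟨g, g • x, Or.inl rfl, rfl, rfl⟩
        exact (hinl _ _).trans h1.reachable
    exact (SimpleGraph.connected_iff_exists_forall_reachable _).2 ⟨_, hbase⟩
  · have hcut : ∀ (s : T.Collapsed x y) (B : G ⧸ C), T.LineIncident x y C s B →
        ∀ (s' : T.Collapsed x y) (B' : G ⧸ C), T.LineIncident x y C s' B' →
        ¬ (s = s' ∧ B = B') → (lineCut s B (.inl s') ↔ lineCut s B (.inr B')) := by
      intro s B h s' B' h' hne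
      constructor
      · intro hs'
        refine ⟨?_, s', h', hs'⟩
        rintro rfl
        have hss : s ≠ s' := fun hss => hne ⟨hss, rfl⟩
        obtain ⟨k, hk⟩ : ∃ k, ¬ (s.1 k ↔ s'.1 k) := by
          by_contra hall
          push Not at hall
          exact hss (Subtype.ext (funext fun k => propext (by have := hall k; tauto)))
        exact hk (hs' k (hsep h h' hk))
      · rintro ⟨hBB, s'', hs'', hP⟩ k hk
        rw [hP k hk]
        by_contra hk'
        exact hBB ((hsep hs'' h' hk').symm.trans hk)
    have h0 : ∀ (s : T.Collapsed x y) (B : G ⧸ C),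
        lineCut s B (.inl s) ≠ lineCut s B (.inr B) := by
      intro s B h
      have h1 : lineCut s B (.inl s) := fun k _ => Iff.rfl
      rw [h] at h1
      exact h1.1 rfl
    have hcut' : ∀ (s : T.Collapsed x y) (B : G ⧸ C), T.LineIncident x y C s B → ∀ a b,
        (lineGraph x y C).Adj a b → s(a, b) ≠ s(.inl s, .inr B) →
          lineCut s B a = lineCut s B b := by
      rintro s B h (t | D) (t' | D') h' hne
      · exact h'.elim
      · exact propext (hcut s B h t D' h' fun hh => hne (by rw [hh.1, hh.2]))
      · exact (propext (hcut s B h t' D h' fun hh => hne (by rw [hh.1, hh.2, Sym2.eq_swap]))).symm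
      · exact h'.elim
    refine SimpleGraph.isAcyclic_of_cuts (α := Prop) ?_
    rintro (s | B) (s' | B') h
    · exact h.elim
    · exact ⟨lineCut s B', h0 s B', hcut' s B' h⟩
    · refine ⟨lineCut s' B, (h0 s' B).symm, fun a b hab hne => hcut' s' B h a b hab ?_⟩
      rwa [Sym2.eq_swap (a := Sum.inl s')]
    · exact h.elim

/-- The tree of lines: all edges of `T` outside the orbit of `xy` are collapsed, and each translate
of the axis of `C` is replaced by a star. -/
def FiniteEdgeStabilizers.lineTree (hT : T.FiniteEdgeStabilizers) {x y : T.X}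
    (hxy : T.graph.Adj x y) {C : Subgroup G} (haxis : T.OnAxis C.subtype x y)
    (huniq : ∀ g : G, T.OnAxis C.subtype (g • x) (g • y) → g ∈ C) : GTree G where
  X := T.Collapsed x y ⊕ G ⧸ C
  graph := lineGraph x y C
  isTree := hT.lineGraph_isTree hxy haxis huniq
  adj_smul := by
    rintro g (s | B) (s' | B') h
    · exact h
    · exact LineIncident.smul T h g
    · exact LineIncident.smul T h g
    · exact h
  no_inversion := by
    rintro g (s | B) (s' | B') h
    · exact h.elim
    · rintro ⟨h1, -⟩
      cases h1
    · rintro ⟨h1, -⟩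
      cases h1
    · exact h.elim

/-- Suppose that among the translates of the axis of the two-ended group `C` only this axis itself
contains the edge `xy`, and that no axis of the other groups in `𝓗` contains a translate of `xy`.
Then the tree of lines shows that `G` splits relative to `𝓗`, unless `G` is two-ended. -/
theorem FiniteEdgeStabilizers.splits_of_onAxis (hT : T.FiniteEdgeStabilizers) {x y : T.X}
    (hxy : T.graph.Adj x y) {C : Subgroup G} (hC : IsTwoEnded C)
    (haxis : T.OnAxis C.subtype x y)
    (huniq : ∀ g : G, T.OnAxis C.subtype (g • x) (g • y) → g ∈ C) (hG : ¬ IsTwoEnded G)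
    (𝓗 : Set (Subgroup G)) (h𝓗 : ∀ H ∈ 𝓗, H = C ∨
      IsTwoEnded H ∧ ∀ g : G, ¬ T.OnAxis H.subtype (g • x) (g • y)) :
    SplitsOverFiniteRel G 𝓗 := by
  -- the group `C` does not fix a vertex of the collapsed tree, and neither do its infinite subgroups
  have hfix : ∀ (K : Subgroup C) [K.FiniteIndex] (q : T.X), ∃ k ∈ K,
      (k : G) • T.toCollapsed x y q ≠ T.toCollapsed x y q := by
    intro K _ q
    obtain ⟨h1, h2⟩ := hT.onAxis_finiteIndex C.subtype_injective hxy haxis K q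
    obtain ⟨⟨k, hk⟩, h1⟩ := h1.nonempty
    obtain ⟨⟨l, hl⟩, h2⟩ := h2.nonempty
    by_contra hall
    push Not at hall
    have h3 := (hall k hk).trans (hall l hl).symm
    rw [smul_toCollapsed, smul_toCollapsed] at h3
    have h4 := congrFun (congrArg Subtype.val h3) 1
    simp only [toCollapsed, position, one_smul] at h4
    exact h2 (h4 ▸ h1)
  have hstab : ∀ (s : T.Collapsed x y) (B : G ⧸ C), T.LineIncident x y C s B →
      Finite (MulAction.stabilizer G s ⊓ MulAction.stabilizer G B : Subgroup G) := by
    rintro _ _ ⟨g, q, hq, rfl, rfl⟩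
    by_contra hinf
    rw [not_finite_iff_infinite] at hinf
    set K := MulAction.stabilizer G (T.toCollapsed x y q) ⊓ MulAction.stabilizer G (g : G ⧸ C)
    let K' : Subgroup C := K.comap ((MulAut.conj g).toMonoidHom.comp C.subtype)
    have hmem : ∀ k ∈ K, g⁻¹ * k * g ∈ C := by
      intro k hk
      have h1 : ((k * g : G) : G ⧸ C) = g := hk.2
      rw [eq_comm, QuotientGroup.eq] at h1
      rwa [mul_assoc]
    let F : K → K' := fun k => ⟨⟨g⁻¹ * k * g, hmem _ k.2⟩, by
      rw [Subgroup.mem_comap]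
      convert k.2 using 1
      simp [mul_assoc]⟩
    have hF : Function.Injective F := by
      intro k l hkl
      have h1 : g⁻¹ * (k : G) * g = g⁻¹ * l * g := congrArg (fun a : K' => ((a : C) : G)) hkl
      exact Subtype.ext (by simpa using h1)
    have : Infinite K' := Infinite.of_injective F hF
    have := hC.finiteIndex_of_infinite K'
    obtain ⟨k, hk, hne⟩ := hfix K' (g⁻¹ • q)
    apply hne
    have h1 : (g * k * g⁻¹ : G) • T.toCollapsed x y q = T.toCollapsed x y q := hk.1
    rw [mul_assoc, mul_smul, ← eq_inv_smul_iff] at h1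
    rw [← smul_toCollapsed, ← mul_smul, h1]
  refine ⟨hT.lineTree hxy haxis huniq, ?_, ?_, ?_⟩
  · rintro (⟨_, q, rfl⟩ | B) hx
    · obtain ⟨k, -, hne⟩ := hfix ⊤ q
      have h1 : (k : G) ∈ MulAction.stabilizer G
          (Sum.inl (T.toCollapsed x y q) : T.Collapsed x y ⊕ G ⧸ C) := by
        change (k : G) ∈ MulAction.stabilizer G
          (show (hT.lineTree hxy haxis huniq).X from Sum.inl (T.toCollapsed x y q))
        exact hx.ge (Subgroup.mem_top (k : G))
      exact hne (Sum.inl_injective h1)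
    · obtain ⟨g, rfl⟩ := QuotientGroup.mk_surjective B
      -- a group that preserves a line is equal to a conjugate of `C`
      apply hG
      have htop : C = ⊤ := by
        rw [eq_top_iff]
        intro k _
        have h1 : (g * k * g⁻¹ : G) • (g : G ⧸ C) = g :=
          Sum.inr_injective (hx.ge (Subgroup.mem_top (g * k * g⁻¹)))
        have h2 : ((g * k * g⁻¹ * g : G) : G ⧸ C) = g := h1
        rw [eq_comm, QuotientGroup.eq] at h2
        simpa [mul_assoc] using h2
      subst htop
      exact hC.of_equiv Subgroup.topEquiv
  · rintro (s | B) (s' | B') h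
    · exact h.elim
    · refine @Finite.of_injective _ _ (hstab s B' h) (fun k => ⟨k.1, ?_, ?_⟩) ?_
      · exact Sum.inl_injective k.2.1
      · exact Sum.inr_injective k.2.2
      · exact fun k l hkl => Subtype.ext (Subtype.mk.inj hkl)
    · refine @Finite.of_injective _ _ (hstab s' B h) (fun k => ⟨k.1, ?_, ?_⟩) ?_
      · exact Sum.inl_injective k.2.2
      · exact Sum.inr_injective k.2.1
      · exact fun k l hkl => Subtype.ext (Subtype.mk.inj hkl)
    · exact h.elim
  · intro H hH
    rcases h𝓗 H hH with rfl | ⟨⟨z, hz, hfin⟩, hno⟩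
    · refine ⟨Sum.inr ((1 : G) : G ⧸ H), fun k hk => congrArg Sum.inr ?_⟩
      change ((k * 1 : G) : G ⧸ H) = (1 : G)
      rw [eq_comm, QuotientGroup.eq]
      simpa using hk
    · obtain ⟨p, hp⟩ := hT.exists_onAxis_of_separating H.subtype_injective hz
      have h1 := (hT.lineTree hxy haxis huniq).elliptic_of_zpowers H.subtype z
        (p := Sum.inl (T.toCollapsed x y p)) (congrArg Sum.inl (by
          change (z : G) • T.toCollapsed x y p = _
          rw [smul_toCollapsed]
          refine Subtype.ext (funext fun g => propext ?_)
          by_contra hsep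
          exact hno g (hp _ _ (T.adj_smul g _ _ hxy) fun h => hsep h.symm)))
      rwa [Subgroup.range_subtype] at h1

end GTree

/-! ### The path group -/

namespace GraphOfGroups

variable {V E : Type u} (𝒢 : GraphOfGroups V E)

/-- The homomorphism of a vertex group to the path group. -/
def ofVertexHom (v : V) : 𝒢.VG v →* 𝒢.PathGroup :=
  (QuotientGroup.mk' (Subgroup.normalClosure 𝒢.relators)).comp
    (Monoid.Coprod.inl.comp Monoid.CoprodI.of)

theorem ofVertexHom_apply (v : V) (g : 𝒢.VG v) : 𝒢.ofVertexHom v g = 𝒢.ofVertex v g := rfl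

theorem ofVertex_mul (v : V) (g h : 𝒢.VG v) :
    𝒢.ofVertex v (g * h) = 𝒢.ofVertex v g * 𝒢.ofVertex v h :=
  map_mul (𝒢.ofVertexHom v) g h

theorem ofVertex_one (v : V) : 𝒢.ofVertex v 1 = 1 := map_one (𝒢.ofVertexHom v)

theorem ofEdge_mul_ofVertex (e : E) (a : 𝒢.EG e) :
    𝒢.ofEdge e * 𝒢.ofVertex _ (𝒢.incl e true a) =
      𝒢.ofVertex _ (𝒢.incl e false a) * 𝒢.ofEdge e := by
  have h : QuotientGroup.mk' (Subgroup.normalClosure 𝒢.relators)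
      (𝒢.ofEdge₀ e * 𝒢.ofVertex₀ _ (𝒢.incl e true a) * (𝒢.ofEdge₀ e)⁻¹ *
        (𝒢.ofVertex₀ _ (𝒢.incl e false a))⁻¹) = 1 := by
    rw [QuotientGroup.mk'_apply, QuotientGroup.eq_one_iff]
    exact Subgroup.subset_normalClosure ⟨e, a, rfl⟩
  rw [map_mul, map_mul, map_mul, map_inv, map_inv, mul_inv_eq_one, mul_inv_eq_iff_eq_mul] at h
  exact h

/-- The universal property of the path group. -/
theorem exists_lift {H : Type*} [Group H] (fv : ∀ v, 𝒢.VG v →* H) (fe : E → H)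
    (h : ∀ (e : E) (a : 𝒢.EG e), fe e * fv _ (𝒢.incl e true a) =
      fv _ (𝒢.incl e false a) * fe e) :
    ∃ F : 𝒢.PathGroup →* H, (∀ v g, F (𝒢.ofVertex v g) = fv v g) ∧
      ∀ e, F (𝒢.ofEdge e) = fe e := by
  let F₀ : 𝒢.FreeProd →* H := Monoid.Coprod.lift (Monoid.CoprodI.lift fv) (FreeGroup.lift fe)
  have hv : ∀ v g, F₀ (𝒢.ofVertex₀ v g) = fv v g := fun v g => by
    simp [F₀, ofVertex₀]
  have he : ∀ e, F₀ (𝒢.ofEdge₀ e) = fe e := fun e => by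
    simp [F₀, ofEdge₀]
  have hker : Subgroup.normalClosure 𝒢.relators ≤ F₀.ker := by
    refine Subgroup.normalClosure_le_normal ?_
    rintro _ ⟨e, a, rfl⟩
    rw [SetLike.mem_coe, MonoidHom.mem_ker]
    rw [map_mul, map_mul, map_mul, map_inv, map_inv, he, hv, hv, h]
    group
  exact ⟨QuotientGroup.lift _ F₀ hker, hv, he⟩

variable {𝒢} in
theorem hom_ext {H : Type*} [Group H] {F F' : 𝒢.PathGroup →* H}
    (hv : ∀ v g, F (𝒢.ofVertex v g) = F' (𝒢.ofVertex v g))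
    (he : ∀ e, F (𝒢.ofEdge e) = F' (𝒢.ofEdge e)) : F = F' := by
  refine QuotientGroup.monoidHom_ext _ (Monoid.Coprod.hom_ext ?_ ?_)
  · exact Monoid.CoprodI.ext_hom _ _ fun v => MonoidHom.ext fun g => hv v g
  · exact FreeGroup.ext_hom _ _ fun e => he e

/-- The vertex groups embed into the path group. To see this let all vertex groups act freely on one
infinite set, with as many orbits as the set has elements. Then the two actions of each edge group
are isomorphic, so that there are permutations to which the stable letters can be mapped. -/
theorem ofVertexHom_injective (v : V) : Function.Injective (𝒢.ofVertexHom v) := by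
  let K : Type u := (Σ w, 𝒢.VG w) × ℕ
  have : Nonempty (Σ w, 𝒢.VG w) := ⟨⟨v, 1⟩⟩
  have hK : Cardinal.aleph0 ≤ Cardinal.mk K := Cardinal.aleph0_le_mk K
  have hle : ∀ w, Cardinal.mk (𝒢.VG w) ≤ Cardinal.mk K := fun w =>
    Cardinal.mk_le_of_injective (f := fun g : 𝒢.VG w => ((⟨w, g⟩, 0) : K))
      fun g h hgh => by simpa [K] using hgh
  -- a set no larger than `K` does not change the cardinality of `K` as a factor
  have habs : ∀ A : Type u, Nonempty A → Cardinal.mk A ≤ Cardinal.mk K → Nonempty (A × K ≃ K) := by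
    intro A _ hA
    rw [← Cardinal.eq, Cardinal.mk_prod, Cardinal.lift_id, Cardinal.lift_id]
    exact Cardinal.mul_eq_right hK hA (Cardinal.mk_ne_zero A)
  let α : ∀ w, 𝒢.VG w × K ≃ K := fun w => (habs (𝒢.VG w) ⟨1⟩ (hle w)).some
  -- the free action of the group at `w` on `K`
  let act : ∀ w, 𝒢.VG w →* Equiv.Perm K := fun w =>
    { toFun := fun g => (α w).symm.trans (((Equiv.mulLeft g).prodCongr (Equiv.refl K)).trans (α w))
      map_one' := by
        ext1 k
        obtain ⟨⟨a, k⟩, rfl⟩ := (α w).surjective k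
        simp
      map_mul' := fun g h => by
        ext1 k
        obtain ⟨⟨a, k⟩, rfl⟩ := (α w).surjective k
        simp [mul_assoc] }
  have hact : ∀ w g h k, act w g (α w (h, k)) = α w (g * h, k) := by
    intro w g h k
    simp [act]
  have horb : ∀ (w : V) (C : Type u) [Group C] (ι : C →* 𝒢.VG w), Function.Injective ι →
      ∃ β : K ≃ C × K, ∀ (c d : C) (k : K), act w (ι c) (β.symm (d, k)) = β.symm (c * d, k) := by
    intro w C _ ι hι
    obtain ⟨S, hS, -⟩ := ι.range.exists_isComplement_right 1
    obtain ⟨s₀, hs₀, -⟩ := Function.Bijective.existsUnique hS (1 : 𝒢.VG w)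
    have : Nonempty S := ⟨s₀.2⟩
    obtain ⟨γ⟩ := habs S this ((Cardinal.mk_set_le S).trans (hle w))
    let κ : C ≃ ι.range := (MonoidHom.ofInjective hι).toEquiv
    let β : K ≃ C × K := (α w).symm.trans <|
      (hS.equiv.prodCongr (Equiv.refl K)).trans <|
      ((κ.symm.prodCongr (Equiv.refl S)).prodCongr (Equiv.refl K)).trans <|
      (Equiv.prodAssoc C S K).trans ((Equiv.refl C).prodCongr γ)
    refine ⟨β, fun c d k => ?_⟩
    have hβ : ∀ d k, β.symm (d, k) = α w (ι d * (γ.symm k).1, (γ.symm k).2) := by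
      intro d k
      rw [Equiv.symm_apply_eq]
      have h2 : hS.equiv (ι d * ((γ.symm k).1 : 𝒢.VG w)) = (κ d, (γ.symm k).1) := by
        rw [← Equiv.eq_symm_apply]
        rfl
      simp only [β, Equiv.trans_apply, Equiv.symm_apply_apply]
      simp only [Equiv.prodCongr_apply, Prod.map, h2, Equiv.prodAssoc_apply]
      simp
    rw [hβ, hβ, hact, map_mul, mul_assoc]
  choose β hβ using fun e b => horb _ _ (𝒢.incl e b) (𝒢.incl_injective e b)
  obtain ⟨F, hF, -⟩ := 𝒢.exists_lift act (fun e => (β e true).trans (β e false).symm) (by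
    intro e a
    ext1 k
    obtain ⟨⟨d, k⟩, rfl⟩ := (β e true).symm.surjective k
    rw [Equiv.Perm.mul_apply, Equiv.Perm.mul_apply, hβ]
    simp [hβ])
  intro g h hgh
  have h1 : act v g = act v h := by
    rw [← hF, ← hF]
    exact congrArg F hgh
  have h2 := congrArg (fun p : Equiv.Perm K => p (α v (1, Classical.arbitrary K))) h1
  simpa [hact] using h2

theorem ofVertex_injective (v : V) : Function.Injective (𝒢.ofVertex v) :=
  𝒢.ofVertexHom_injective v

/-- A derivation on the path group may be prescribed on the vertex groups and on the stable letters,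
provided that it is compatible with the relators. -/
theorem exists_derivation {M : Type*} [AddCommGroup M] [DistribMulAction 𝒢.PathGroup M]
    (δ : ∀ v, 𝒢.VG v → M)
    (hδ : ∀ v g h, δ v (g * h) = δ v g + 𝒢.ofVertex v g • δ v h) (m : E → M)
    (hm : ∀ (e : E) (a : 𝒢.EG e), m e + 𝒢.ofEdge e • δ _ (𝒢.incl e true a) =
      δ _ (𝒢.incl e false a) + 𝒢.ofVertex _ (𝒢.incl e false a) • m e) :
    ∃ d : 𝒢.PathGroup → M, (∀ x y, d (x * y) = d x + x • d y) ∧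
      (∀ v g, d (𝒢.ofVertex v g) = δ v g) ∧ ∀ e, d (𝒢.ofEdge e) = m e := by
  let φ : 𝒢.PathGroup →* MulAut (Multiplicative M) :=
    (MulAutMultiplicative M).symm.toMonoidHom.comp (DistribMulAction.toAddAut 𝒢.PathGroup M)
  have hφ : ∀ x (n : M), φ x (Multiplicative.ofAdd n) = Multiplicative.ofAdd (x • n) :=
    fun _ _ => rfl
  obtain ⟨F, hFv, hFe⟩ := 𝒢.exists_lift (H := Multiplicative M ⋊[φ] 𝒢.PathGroup)
    (fun v =>
      { toFun := fun g => ⟨Multiplicative.ofAdd (δ v g), 𝒢.ofVertex v g⟩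
        map_one' := by
          have h := hδ v 1 1
          rw [mul_one, ofVertex_one, one_smul, left_eq_add] at h
          rw [h, ofVertex_one]
          rfl
        map_mul' := fun g h => by
          ext
          · rw [SemidirectProduct.mul_left, hφ, ← ofAdd_add, hδ]
          · rw [SemidirectProduct.mul_right, ofVertex_mul] })
    (fun e => ⟨Multiplicative.ofAdd (m e), 𝒢.ofEdge e⟩) (by
      intro e a
      ext
      · simp only [MonoidHom.coe_mk, OneHom.coe_mk]
        rw [SemidirectProduct.mul_left, SemidirectProduct.mul_left, hφ, hφ, ← ofAdd_add,
          ← ofAdd_add, hm]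
      · exact 𝒢.ofEdge_mul_ofVertex e a)
  have hright : ∀ x, (F x).right = x := by
    have h : SemidirectProduct.rightHom.comp F = MonoidHom.id _ :=
      hom_ext (fun v g => by simp [hFv]) (fun e => by simp [hFe])
    exact fun x => DFunLike.congr_fun h x
  refine ⟨fun x => (F x).left.toAdd, fun x y => ?_, fun v g => ?_, fun e => ?_⟩
  · simp only [map_mul, SemidirectProduct.mul_left, hright]
    rfl
  · simp only [hFv]
    rfl
  · simp only [hFe]
    rfl

end GraphOfGroups

/-! ### The Bass–Serre forest -/

/-- Functions with values mod 2 on a set with an action of `P`, as a module over `P`. -/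
def Cochain (Ω : Type*) : Type _ := Ω → ZMod 2

namespace Cochain

variable {P Ω : Type*} [Group P] [MulAction P Ω]

instance : AddCommGroup (Cochain Ω) := inferInstanceAs (AddCommGroup (Ω → ZMod 2))

instance : DistribMulAction P (Cochain Ω) where
  smul g f := fun a => f (g⁻¹ • a)
  one_smul f := funext fun a => by
    change f ((1 : P)⁻¹ • a) = f a
    simp
  mul_smul g h f := funext fun a => by
    change f ((g * h)⁻¹ • a) = f (h⁻¹ • g⁻¹ • a)
    rw [mul_inv_rev, mul_smul]
  smul_zero _ := rfl
  smul_add _ _ _ := rfl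

theorem smul_apply (g : P) (f : Cochain Ω) (a : Ω) : (g • f) a = f (g⁻¹ • a) := rfl

end Cochain

/-- In a multigraph in which each edge is the only one across which a certain function changes, that
is, in a forest, a finite non-empty set of edges has a vertex of degree one. -/
theorem exists_leaf_of_cuts {U Ed α : Type*} (ends : Ed → Bool → U) (D : U → Ed → α)
    (hD : ∀ ε, D (ends ε false) ε ≠ D (ends ε true) ε)
    (hD' : ∀ ε η, η ≠ ε → D (ends ε false) η = D (ends ε true) η)
    (F : Set Ed) (hF : F.Finite) (hne : F.Nonempty) :
    ∃ ε ∈ F, ∃ b, ∀ ε' ∈ F, ∀ b', ends ε' b' = ends ε b → ε' = ε ∧ b' = b := by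
  classical
  have hDb : ∀ ε b, D (ends ε b) ε ≠ D (ends ε (!b)) ε := by
    rintro ε (_ | _)
    · exact hD ε
    · exact (hD ε).symm
  have hDb' : ∀ ε b η, η ≠ ε → D (ends ε b) η = D (ends ε (!b)) η := by
    rintro ε (_ | _) η h
    · exact hD' ε η h
    · exact (hD' ε η h).symm
  let K : SimpleGraph U :=
    { Adj := fun u u' => ∃ ε ∈ F, ∃ b, ends ε b = u ∧ ends ε (!b) = u'
      symm.symm := by
        rintro _ _ ⟨ε, hε, b, rfl, rfl⟩
        exact ⟨ε, hε, !b, rfl, by rw [Bool.not_not]⟩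
      loopless.irrefl := by
        rintro _ ⟨ε, hε, b, rfl, h⟩
        exact hDb ε b (by rw [h]) }
  have hacyc : K.IsAcyclic := by
    refine SimpleGraph.isAcyclic_of_cuts (α := α) ?_
    rintro _ _ ⟨ε, hε, b, rfl, rfl⟩
    refine ⟨fun q => D q ε, hDb ε b, ?_⟩
    rintro _ _ ⟨ε', hε', b', rfl, rfl⟩ hne
    apply hDb'
    rintro rfl
    apply hne
    cases b <;> cases b' <;> simp
  obtain ⟨ε₀, hε₀⟩ := hne
  set u₀ := ends ε₀ false with hu₀
  set R := {u | K.Reachable u₀ u}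
  have hRfin : R.Finite := by
    refine ((Set.finite_singleton u₀).union
      ((hF.prod (Set.finite_univ (α := Bool))).image fun x => ends x.1 x.2)).subset ?_
    rintro u ⟨w⟩
    by_cases hu : u = u₀
    · exact Or.inl hu
    · obtain ⟨ε, hε, b, -, h2⟩ := w.adj_penultimate (SimpleGraph.Walk.not_nil_of_ne (Ne.symm hu))
      exact Or.inr ⟨(ε, !b), ⟨hε, Set.mem_univ _⟩, h2⟩
  -- a vertex at maximal distance from `u₀`
  obtain ⟨u, hu, hmax⟩ := Set.exists_max_image R (K.dist u₀) hRfin ⟨u₀, SimpleGraph.Reachable.refl _⟩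
  obtain ⟨p, hp, hlen⟩ := SimpleGraph.Reachable.exists_path_of_dist hu
  have hnbr : ∀ v, K.Adj u v → v = p.penultimate := by
    intro v hv
    refine hacyc.eq_penultimate_of_adj_end hp hv ?_
    by_contra hvp
    have hvR : K.Reachable u₀ v := SimpleGraph.Reachable.trans hu hv.reachable
    obtain ⟨r, hr, hrlen⟩ := SimpleGraph.Reachable.exists_path_of_dist hvR
    have h1 := congrArg (fun q : K.Path u₀ v => q.1.length)
      ((hacyc.subsingleton_path u₀ v).elim ⟨r, hr⟩ ⟨p.concat hv, hp.concat hvp hv⟩)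
    simp only [SimpleGraph.Walk.length_concat] at h1
    have h2 := hmax v hvR
    lia
  have hu1 : K.Adj u₀ (ends ε₀ true) := ⟨ε₀, hε₀, false, rfl, rfl⟩
  have huu : u ≠ u₀ := by
    rintro rfl
    have h1 := hmax _ hu1.reachable
    rw [SimpleGraph.dist_self, SimpleGraph.dist_eq_one_iff_adj.2 hu1] at h1
    lia
  have hnil : ¬ p.Nil := SimpleGraph.Walk.not_nil_of_ne huu.symm
  obtain ⟨ε, hε, b, h1, h2⟩ := (p.adj_penultimate hnil).symm
  refine ⟨ε, hε, b, fun ε' hε' b' h => ?_⟩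
  have h3 : ends ε' (!b') = p.penultimate := hnbr _ ⟨ε', hε', b', h.trans h1, rfl⟩
  have h4 : ε' = ε := by
    by_contra hne
    have h5 := hDb' ε' b' ε (Ne.symm hne)
    rw [h, h3, ← h2] at h5
    exact hDb ε b h5
  refine ⟨h4, ?_⟩
  subst h4
  by_contra hb
  have hb' : b = !b' := by
    revert hb
    cases b <;> cases b' <;> decide
  rw [hb'] at h
  exact hDb ε' b' (by rw [h])

namespace GraphOfGroups

variable {V E : Type u} (𝒢 : GraphOfGroups V E)

/-- The image of an edge group in the path group, through the vertex group at its origin. -/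
def edgeSubgroup (e : E) : Subgroup 𝒢.PathGroup :=
  ((𝒢.ofVertexHom (𝒢.ends e false)).comp (𝒢.incl e false)).range

/-- The vertices of the Bass–Serre forest, on which the path group acts. -/
abbrev ForestVertex : Type u := Σ v, 𝒢.PathGroup ⧸ (𝒢.ofVertexHom v).range

/-- The edges of the Bass–Serre forest, on which the path group acts. -/
abbrev ForestEdge : Type u := Σ e, 𝒢.PathGroup ⧸ 𝒢.edgeSubgroup e

/-- The element that takes the coset of a vertex group at an end of an edge to the coset of the edge
group: the trivial element at the origin, the inverse of the stable letter at the terminus. -/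
def halfEdge (e : E) : Bool → 𝒢.PathGroup
  | false => 1
  | true => (𝒢.ofEdge e)⁻¹

theorem halfEdge_mul_ofVertex (e : E) (b : Bool) (a : 𝒢.EG e) :
    𝒢.ofVertex _ (𝒢.incl e b a) * 𝒢.halfEdge e b =
      𝒢.halfEdge e b * 𝒢.ofVertex _ (𝒢.incl e false a) := by
  cases b
  · simp [halfEdge]
  · rw [halfEdge, mul_inv_eq_iff_eq_mul, mul_assoc, ← ofEdge_mul_ofVertex, inv_mul_cancel_left]

variable {𝒢} in
theorem IsPath.mul_halfEdge {v₀ : V} {e : E} {b : Bool} {y : 𝒢.PathGroup}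
    (h : 𝒢.IsPath v₀ (𝒢.ends e b) y) : 𝒢.IsPath v₀ (𝒢.ends e false) (y * 𝒢.halfEdge e b) := by
  cases b
  · simpa [halfEdge] using h
  · exact h.edgeInv e

variable {𝒢} in
theorem IsPath.mul_halfEdge_inv {v₀ : V} {e : E} {b : Bool} {x : 𝒢.PathGroup}
    (h : 𝒢.IsPath v₀ (𝒢.ends e false) x) : 𝒢.IsPath v₀ (𝒢.ends e b) (x * (𝒢.halfEdge e b)⁻¹) := by
  cases b
  · simpa [halfEdge] using h
  · simpa [halfEdge] using h.edge e

/-- The edge of type `e` in the Bass–Serre forest that starts with its end `b` at the vertex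
represented by `y`. -/
def edgeAt (e : E) (b : Bool) (y : 𝒢.PathGroup) : 𝒢.ForestEdge := ⟨e, (y * 𝒢.halfEdge e b : _)⟩

/-- The ends of an edge of the Bass–Serre forest. -/
noncomputable def forestEnds (ε : 𝒢.ForestEdge) (b : Bool) : 𝒢.ForestVertex :=
  ⟨𝒢.ends ε.1 b, (ε.2.out * (𝒢.halfEdge ε.1 b)⁻¹ : 𝒢.PathGroup)⟩

variable {𝒢} in
theorem forestVertex_eq {v w : V} (h : v = w) (x : 𝒢.PathGroup) :
    (⟨v, (x : 𝒢.PathGroup ⧸ (𝒢.ofVertexHom v).range)⟩ : 𝒢.ForestVertex) = ⟨w, (x : _)⟩ := by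
  subst h
  rfl

theorem forestEnds_mk (e : E) (b : Bool) (x : 𝒢.PathGroup) :
    𝒢.forestEnds ⟨e, (x : _)⟩ b = ⟨𝒢.ends e b, (x * (𝒢.halfEdge e b)⁻¹ : 𝒢.PathGroup)⟩ := by
  obtain ⟨⟨_, a, rfl⟩, hr⟩ := QuotientGroup.mk_out_eq_mul (𝒢.edgeSubgroup e) x
  simp only [forestEnds, hr]
  congr 1
  symm
  rw [QuotientGroup.eq]
  refine ⟨𝒢.incl e b a, ?_⟩
  have h := 𝒢.halfEdge_mul_ofVertex e b a
  rw [ofVertexHom_apply, eq_comm, ← mul_inv_eq_iff_eq_mul.2 h.symm]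
  simp only [MonoidHom.comp_apply, ofVertexHom_apply]
  group

theorem forestEnds_edgeAt (e : E) (b : Bool) (y : 𝒢.PathGroup) :
    𝒢.forestEnds (𝒢.edgeAt e b y) b = ⟨𝒢.ends e b, (y : _)⟩ := by
  rw [edgeAt, forestEnds_mk, mul_inv_cancel_right]

/-- The Bass–Serre forest has no cycles: there is a function on its vertices, coming from the
derivation of the path group that maps each stable letter to the corresponding edge, each coordinate
of which changes across a single edge. -/
theorem exists_forest_cuts : ∃ D : 𝒢.ForestVertex → 𝒢.ForestEdge → ZMod 2,
    (∀ ε, D (𝒢.forestEnds ε false) ε ≠ D (𝒢.forestEnds ε true) ε) ∧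
      ∀ ε η, η ≠ ε → D (𝒢.forestEnds ε false) η = D (𝒢.forestEnds ε true) η := by
  classical
  let M := Cochain 𝒢.ForestEdge
  let m : E → M := fun e => (Pi.single ⟨e, ((1 : 𝒢.PathGroup) : _)⟩ 1 : 𝒢.ForestEdge → ZMod 2)
  have hm : ∀ (e : E) (r : 𝒢.PathGroup), r ∈ 𝒢.edgeSubgroup e → r • m e = m e := by
    intro e r hr
    funext ε
    rw [Cochain.smul_apply]
    have h : r⁻¹ • ε = ⟨e, ((1 : 𝒢.PathGroup) : _)⟩ ↔ ε = ⟨e, ((1 : 𝒢.PathGroup) : _)⟩ := by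
      rw [inv_smul_eq_iff]
      have : (r • ⟨e, ((1 : 𝒢.PathGroup) : _)⟩ : 𝒢.ForestEdge) =
          ⟨e, ((1 : 𝒢.PathGroup) : _)⟩ := by
        change (⟨e, ((r * 1 : 𝒢.PathGroup) : _)⟩ : 𝒢.ForestEdge) = _
        congr 1
        rw [eq_comm, QuotientGroup.eq]
        simpa using hr
      rw [this]
    simp only [m, Pi.single_apply, h]
  obtain ⟨d, hd, hdv, hde⟩ := 𝒢.exists_derivation (M := M) (fun _ _ => 0)
    (by simp) m (by
      intro e a
      rw [smul_zero, add_zero, zero_add, hm]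
      exact ⟨a, rfl⟩)
  have hdr : ∀ v x (r : 𝒢.PathGroup), r ∈ (𝒢.ofVertexHom v).range → d (x * r) = d x := by
    rintro v x _ ⟨g, rfl⟩
    rw [hd, ofVertexHom_apply, hdv, smul_zero, add_zero]
  let D : 𝒢.ForestVertex → 𝒢.ForestEdge → ZMod 2 := fun u => d u.2.out
  have hD : ∀ v x, D ⟨v, ((x : 𝒢.PathGroup) : _)⟩ = d x := by
    intro v x
    obtain ⟨r, hr⟩ := QuotientGroup.mk_out_eq_mul (𝒢.ofVertexHom v).range x
    change d (Quotient.out _) = _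
    rw [hr, hdr v x _ r.2]
  have hdiff : ∀ (ε η : 𝒢.ForestEdge), D (𝒢.forestEnds ε true) η =
      D (𝒢.forestEnds ε false) η + if η = ε then 1 else 0 := by
    rintro ⟨e, q⟩ η
    obtain ⟨x, rfl⟩ := QuotientGroup.mk_surjective q
    rw [forestEnds_mk, forestEnds_mk, hD, hD]
    simp only [halfEdge, inv_inv, inv_one, mul_one]
    rw [hd, hde]
    change d x η + (x • m e) η = _
    rw [Cochain.smul_apply]
    have h : x⁻¹ • η = ⟨e, ((1 : 𝒢.PathGroup) : _)⟩ ↔ η = ⟨e, (x : _)⟩ := by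
      rw [inv_smul_eq_iff]
      have : (x • ⟨e, ((1 : 𝒢.PathGroup) : _)⟩ : 𝒢.ForestEdge) = ⟨e, (x : _)⟩ := by
        change (⟨e, ((x * 1 : 𝒢.PathGroup) : _)⟩ : 𝒢.ForestEdge) = _
        rw [mul_one]
      rw [this]
    simp only [m, Pi.single_apply, h]
  refine ⟨D, fun ε h => ?_, fun ε η hne => ?_⟩
  · rw [hdiff, if_pos rfl, left_eq_add] at h
    exact one_ne_zero h
  · rw [hdiff, if_neg hne, add_zero]

/-- A finite non-empty set of edges of the Bass–Serre forest has a vertex at which exactly one of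
these edges starts. -/
theorem exists_forest_leaf (F : Set 𝒢.ForestEdge) (hF : F.Finite) (hne : F.Nonempty) :
    ∃ (e : E) (b : Bool) (y : 𝒢.PathGroup), 𝒢.edgeAt e b y ∈ F ∧
      ∀ (e' : E) (b' : Bool), 𝒢.ends e' b' = 𝒢.ends e b → ∀ g : 𝒢.VG (𝒢.ends e b),
        𝒢.edgeAt e' b' (y * 𝒢.ofVertex _ g) ∈ F →
          e' = e ∧ b' = b ∧ g ∈ (𝒢.incl e b).range := by
  obtain ⟨D, hD, hD'⟩ := 𝒢.exists_forest_cuts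
  obtain ⟨⟨e, q⟩, hε, b, huniq⟩ := exists_leaf_of_cuts 𝒢.forestEnds D hD hD' F hF hne
  obtain ⟨x, rfl⟩ := QuotientGroup.mk_surjective q
  have hxy : 𝒢.edgeAt e b (x * (𝒢.halfEdge e b)⁻¹) = ⟨e, (x : _)⟩ := by
    rw [edgeAt, inv_mul_cancel_right]
  refine ⟨e, b, x * (𝒢.halfEdge e b)⁻¹, by rwa [hxy], ?_⟩
  generalize x * (𝒢.halfEdge e b)⁻¹ = y at hxy ⊢
  intro e' b' hv g hg
  have hend : 𝒢.forestEnds (𝒢.edgeAt e' b' (y * 𝒢.ofVertex _ g)) b' =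
      𝒢.forestEnds ⟨e, (x : _)⟩ b := by
    rw [← hxy, forestEnds_edgeAt, forestEnds_edgeAt, forestVertex_eq hv]
    congr 1
    rw [eq_comm, QuotientGroup.eq]
    exact ⟨g, by rw [inv_mul_cancel_left]; rfl⟩
  obtain ⟨h1, h2⟩ := huniq _ hg b' hend
  obtain rfl : e' = e := congrArg Sigma.fst h1
  subst h2
  refine ⟨rfl, rfl, ?_⟩
  rw [← hxy, edgeAt, edgeAt] at h1
  have h3 := eq_of_heq (Sigma.mk.inj h1).2
  rw [eq_comm, QuotientGroup.eq] at h3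
  obtain ⟨a, ha⟩ := h3
  refine ⟨a, 𝒢.ofVertex_injective _ ?_⟩
  rw [MonoidHom.comp_apply, ofVertexHom_apply, mul_assoc, mul_inv_rev, mul_assoc,
    inv_mul_cancel_left, ← mul_right_inj (𝒢.halfEdge e' b'), mul_inv_cancel_left,
    ← halfEdge_mul_ofVertex, mul_left_inj] at ha
  exact ha

end GraphOfGroups

/-! ### Vertex groups acting on a tree of the fundamental group -/

namespace GTree

variable {G : Type u} [Group G] {T : GTree G}

theorem onAxis_comp_equiv {C C' : Type u} [Group C] [Group C'] (f : C →* G) (σ : C' ≃* C)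
    (x y : T.X) : T.OnAxis (f.comp σ.toMonoidHom) x y ↔ T.OnAxis f x y := by
  have key : ∀ S : Set C, {c' : C' | σ c' ∈ S}.Infinite ↔ S.Infinite := by
    intro S
    rw [← Set.infinite_image_iff (f := σ) σ.injective.injOn]
    have : σ '' {c' : C' | σ c' ∈ S} = S := Set.image_preimage_eq S σ.surjective
    rw [this]
  exact forall_congr' fun p => and_congr (key {c | f c • p ∈ T.half x y})
    (key {c | f c • p ∉ T.half x y})

theorem comap_smul_onAxis_iff {C H : Type u} [Group C] [Group H] (h : H →* G) (f : C →* H) (g : H)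
    (x y : T.X) : (T.comap h).OnAxis f (h g • x : T.X) (h g • y : T.X) ↔
      T.OnAxis (h.comp ((MulAut.conj g⁻¹).toMonoidHom.comp f)) x y :=
  (T.comap h).smul_onAxis_iff f g x y

/-- A subgroup that fixes two vertices is finite: it fixes an edge on the geodesic. -/
theorem FiniteEdgeStabilizers.finite_of_fixes (hT : T.FiniteEdgeStabilizers) {C : Type u} [Group C]
    {f : C →* G} (hf : Function.Injective f) {p q : T.X} (hp : ∀ c, f c • p = p)
    (hq : ∀ c, f c • q = q) (hne : p ≠ q) : Finite C := by
  obtain ⟨y, hy, hlt⟩ := T.isTree.connected.exists_adj_dist_lt hne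
  have := hT p y hy
  have hfix : ∀ c, f c • y = y := by
    intro c
    have hy' : T.graph.Adj p (f c • y) := by
      have := T.adj_smul (f c) _ _ hy
      rwa [hp] at this
    have hlt' : q ∈ T.half p (f c • y) := by
      have := (T.smul_mem_half (f c) p y q).2 hlt
      rwa [hp, hq] at this
    by_contra hcy
    have hny : y ∉ T.half p (f c • y) := by
      rw [← T.isTree.mem_halfTree_iff_of_adj hy' hy
        (fun he => hcy (Sym2.congr_right.1 he).symm)]
      exact SimpleGraph.source_notMem_halfTree
    have h1 := T.isTree.dist_eq_of_separating hy' hny hlt'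
    have h2 := SimpleGraph.dist_of_mem_halfTree hy hlt
    have h3 := SimpleGraph.dist_of_mem_halfTree hy' hlt'
    rw [SimpleGraph.dist_comm (u := q) (v := y)] at h2
    rw [SimpleGraph.dist_comm (u := q) (v := f c • y)] at h3
    lia
  exact Finite.of_injective (fun c => (⟨f c, hp c, hfix c⟩ : T.edgeStabilizer p y))
    fun c d hcd => hf (congrArg Subtype.val hcd)

/-- In a two-ended group all infinite subgroups have the same axis, and it is invariant. -/
theorem FiniteEdgeStabilizers.onAxis_of_isTwoEnded (hT : T.FiniteEdgeStabilizers)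
    (hG : IsTwoEnded G) {x y : T.X} (hxy : T.graph.Adj x y) {K : Subgroup G}
    (hK : T.OnAxis K.subtype x y) (H : Subgroup G) [Infinite H] (g : G) :
    T.OnAxis H.subtype (g • x) (g • y) := by
  have hid : T.OnAxis (MonoidHom.id G) x y :=
    hT.onAxis_of_subgroup Function.injective_id hxy K hK
  have hidg : T.OnAxis (MonoidHom.id G) (g • x) (g • y) := by
    rw [smul_onAxis_iff]
    exact (onAxis_comp_equiv (MonoidHom.id G) (MulAut.conj g⁻¹) x y).2 hid
  have := hG.finiteIndex_of_infinite H
  exact hT.onAxis_finiteIndex Function.injective_id (T.adj_smul _ _ _ hxy) hidg H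

end GTree

namespace GraphOfGroups

variable {V E : Type u} {𝒢 : GraphOfGroups V E} {v₀ : V}

theorem Connected.exists_isPath (h : 𝒢.Connected) (v w : V) : ∃ x, 𝒢.IsPath v w x := by
  obtain ⟨p⟩ := SimpleGraph.Connected.preconnected h v w
  induction p with
  | nil => exact ⟨1, IsPath.nil⟩
  | cons hadj _ ih =>
    obtain ⟨x, hx⟩ := ih
    obtain ⟨-, ⟨e, rfl, rfl⟩ | ⟨e, rfl, rfl⟩⟩ := (SimpleGraph.fromRel_adj _ _ _).1 hadj
    · exact ⟨_, (IsPath.nil.edge e).trans hx⟩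
    · exact ⟨_, (IsPath.nil.edgeInv e).trans hx⟩

/-- The embedding of the vertex group at `v` into the fundamental group given by a path from the
base vertex to `v`. -/
def conjHom {v : V} {z : 𝒢.PathGroup} (hz : 𝒢.IsPath v₀ v z) :
    𝒢.VG v →* 𝒢.fundamentalGroup v₀ where
  toFun g := ⟨z * 𝒢.ofVertex v g * z⁻¹, (hz.vertex g).trans hz.symm⟩
  map_one' := Subtype.ext (by simp [ofVertex_one])
  map_mul' g h := Subtype.ext (by simp [ofVertex_mul, mul_assoc])

theorem conjHom_coe {v : V} {z : 𝒢.PathGroup} (hz : 𝒢.IsPath v₀ v z) (g : 𝒢.VG v) :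
    (conjHom hz g : 𝒢.PathGroup) = z * 𝒢.ofVertex v g * z⁻¹ := rfl

theorem conjHom_injective {v : V} {z : 𝒢.PathGroup} (hz : 𝒢.IsPath v₀ v z) :
    Function.Injective (conjHom hz) := by
  intro g h hgh
  have h1 := congrArg Subtype.val hgh
  simp only [conjHom_coe, mul_left_inj, mul_right_inj] at h1
  exact 𝒢.ofVertex_injective v h1

/-- The embedding of an edge group into the fundamental group given by a path from the base vertex
to one of its ends. -/
def edgeHom {e : E} {b : Bool} {z : 𝒢.PathGroup} (hz : 𝒢.IsPath v₀ (𝒢.ends e b) z) :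
    𝒢.EG e →* 𝒢.fundamentalGroup v₀ := (conjHom hz).comp (𝒢.incl e b)

theorem edgeHom_injective {e : E} {b : Bool} {z : 𝒢.PathGroup}
    (hz : 𝒢.IsPath v₀ (𝒢.ends e b) z) : Function.Injective (edgeHom hz) :=
  (conjHom_injective hz).comp (𝒢.incl_injective e b)

theorem edgeHom_mul_halfEdge {e : E} {b : Bool} {z : 𝒢.PathGroup}
    (hz : 𝒢.IsPath v₀ (𝒢.ends e b) z) : edgeHom (b := false) hz.mul_halfEdge = edgeHom hz := by
  ext a
  simp only [edgeHom, MonoidHom.comp_apply, conjHom_coe]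
  rw [mul_assoc z, ← halfEdge_mul_ofVertex]
  group

theorem edgeHom_mul_mem {e : E} {z z' : 𝒢.PathGroup} (hz : 𝒢.IsPath v₀ (𝒢.ends e false) z)
    (hz' : 𝒢.IsPath v₀ (𝒢.ends e false) z') {a : 𝒢.EG e}
    (ha : 𝒢.ofVertex _ (𝒢.incl e false a) = z⁻¹ * z') :
    edgeHom hz' = (edgeHom hz).comp (MulAut.conj a).toMonoidHom := by
  have h : z' = z * 𝒢.ofVertex _ (𝒢.incl e false a) := by rw [ha, mul_inv_cancel_left]
  ext c
  simp [edgeHom, conjHom_coe, h, mul_assoc, ofVertex_inv]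

/-- The edges of the Bass–Serre tree whose axes in the tree `T` contain the edge `xy` of `T`. -/
def axisEdges (T : GTree (𝒢.fundamentalGroup v₀)) (x y : T.X) : Set 𝒢.ForestEdge :=
  {ε | ∃ (e : E) (z : 𝒢.PathGroup) (hz : 𝒢.IsPath v₀ (𝒢.ends e false) z),
    ε = ⟨e, (z : _)⟩ ∧ T.OnAxis (edgeHom hz) x y}

variable {T : GTree (𝒢.fundamentalGroup v₀)}

theorem isPath_of_edgeAt_mem {x y : T.X} {e : E} {b : Bool} {z : 𝒢.PathGroup}
    (h : 𝒢.edgeAt e b z ∈ axisEdges T x y) : 𝒢.IsPath v₀ (𝒢.ends e b) z := by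
  obtain ⟨e', z', hz', h1, -⟩ := h
  obtain rfl : e = e' := congrArg Sigma.fst h1
  have h2 := eq_of_heq (Sigma.mk.inj h1).2
  rw [eq_comm, QuotientGroup.eq] at h2
  obtain ⟨a, ha⟩ := h2
  have h3 := (hz'.vertex (𝒢.incl e false a)).mul_halfEdge_inv (b := b)
  have h4 : z' * 𝒢.ofVertex _ (𝒢.incl e false a) * (𝒢.halfEdge e b)⁻¹ = z := by
    rw [MonoidHom.comp_apply, ofVertexHom_apply] at ha
    rw [ha]
    group
  rwa [h4] at h3

theorem edgeAt_mem_axisEdges {x y : T.X} {e : E} {b : Bool} {z : 𝒢.PathGroup}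
    (hz : 𝒢.IsPath v₀ (𝒢.ends e b) z) :
    𝒢.edgeAt e b z ∈ axisEdges T x y ↔ T.OnAxis (edgeHom hz) x y := by
  constructor
  · rintro ⟨e', z', hz', h1, h⟩
    obtain rfl : e = e' := congrArg Sigma.fst h1
    have h2 := eq_of_heq (Sigma.mk.inj h1).2
    rw [eq_comm, QuotientGroup.eq] at h2
    obtain ⟨a, ha⟩ := h2
    rw [← edgeHom_mul_halfEdge, edgeHom_mul_mem hz' hz.mul_halfEdge ha,
      GTree.onAxis_comp_equiv]
    exact h
  · intro h
    refine ⟨e, _, hz.mul_halfEdge, rfl, ?_⟩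
    rwa [edgeHom_mul_halfEdge]

/-- Each edge group has finitely many orbits of edges on its axis, and edge stabilisers are finite,
so that only finitely many translates of the axis contain `xy`. -/
theorem finite_axisEdges [Finite E] (hedge : ∀ e : E, IsTwoEnded (𝒢.EG e))
    (hT : T.FiniteEdgeStabilizers) {x y : T.X} (hxy : T.graph.Adj x y) :
    (axisEdges T x y).Finite := by
  have h : ∀ e : E, {ε | ε ∈ axisEdges T x y ∧ ε.1 = e}.Finite := by
    intro e
    by_cases hpath : ∃ z, 𝒢.IsPath v₀ (𝒢.ends e false) z
    · obtain ⟨z₁, hz₁⟩ := hpath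
      obtain ⟨Φ, hΦ, hΦ'⟩ := hT.finite_onAxis_orbits (hedge e) (edgeHom_injective hz₁)
      have hN := hΦ.biUnion (t := fun e => {g : 𝒢.fundamentalGroup v₀ | g • x = e.1 ∧ g • y = e.2})
        fun e _ => hT.finite_transporter hxy e.1 e.2
      refine (hN.image fun k : 𝒢.fundamentalGroup v₀ =>
        (⟨e, ((k : 𝒢.PathGroup)⁻¹ * z₁ : 𝒢.PathGroup)⟩ : 𝒢.ForestEdge)).subset ?_
      rintro _ ⟨⟨e', z, hz, rfl, h⟩, rfl⟩
      let γ : 𝒢.fundamentalGroup v₀ := ⟨z * z₁⁻¹, hz.trans hz₁.symm⟩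
      have h1 : edgeHom hz = (MulAut.conj (γ⁻¹)⁻¹).toMonoidHom.comp (edgeHom hz₁) := by
        ext c
        simp [edgeHom, conjHom_coe, γ, mul_assoc]
      rw [h1, ← T.smul_onAxis_iff] at h
      obtain ⟨c, hc⟩ := hΦ' _ _ (T.adj_smul _ _ _ hxy) h
      rw [← mul_smul, ← mul_smul] at hc
      refine ⟨edgeHom hz₁ c * γ⁻¹, ?_, ?_⟩
      · simp only [Set.mem_iUnion]
        exact ⟨_, hc, rfl, rfl⟩
      · refine congrArg (Sigma.mk e') ?_
        rw [QuotientGroup.eq]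
        refine ⟨c, ?_⟩
        simp [γ, edgeHom, conjHom_coe, mul_assoc, ofVertexHom_apply]
    · refine Set.finite_empty.subset ?_
      rintro _ ⟨⟨e', z, hz, rfl, -⟩, rfl⟩
      exact hpath ⟨z, hz⟩
  refine (Set.finite_iUnion h).subset fun ε hε => ?_
  exact Set.mem_iUnion.2 ⟨ε.1, hε, rfl⟩

theorem IsIncidentEdgeGroup.isTwoEnded (hedge : ∀ e : E, IsTwoEnded (𝒢.EG e)) {v : V}
    {H : Subgroup (𝒢.VG v)} (hH : 𝒢.IsIncidentEdgeGroup v H) : IsTwoEnded H := by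
  cases hH with
  | mk e b => exact (hedge e).of_equiv (MonoidHom.ofInjective (𝒢.incl_injective e b))

theorem onAxis_range_iff {e : E} {b : Bool} {z : 𝒢.PathGroup}
    (hz : 𝒢.IsPath v₀ (𝒢.ends e b) z) (x y : T.X) (g : 𝒢.VG (𝒢.ends e b)) :
    (T.comap (conjHom hz)).OnAxis (𝒢.incl e b).range.subtype
      (conjHom hz g • x) (conjHom hz g • y) ↔
        𝒢.edgeAt e b (z * 𝒢.ofVertex _ g⁻¹) ∈ axisEdges T x y := by
  have h2 : edgeHom (hz.vertex g⁻¹) = ((conjHom hz).comp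
      ((MulAut.conj g⁻¹).toMonoidHom.comp (𝒢.incl e b).range.subtype)).comp
        (MonoidHom.ofInjective (𝒢.incl_injective e b)).toMonoidHom := by
    ext c
    simp only [edgeHom, conjHom_coe, MonoidHom.comp_apply, MulEquiv.coe_toMonoidHom,
      MulAut.conj_apply, inv_inv, Subgroup.subtype_apply, MonoidHom.ofInjective_apply,
      ofVertex_mul, ← ofVertex_inv]
    group
  rw [edgeAt_mem_axisEdges (hz.vertex g⁻¹), h2, GTree.onAxis_comp_equiv]
  exact GTree.comap_smul_onAxis_iff _ _ _ _ _

theorem onAxis_range_of_mem {e : E} {b : Bool} {z : 𝒢.PathGroup}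
    (hz : 𝒢.IsPath v₀ (𝒢.ends e b) z) {x y : T.X} (h : 𝒢.edgeAt e b z ∈ axisEdges T x y) :
    (T.comap (conjHom hz)).OnAxis (𝒢.incl e b).range.subtype x y := by
  have h1 := onAxis_range_iff hz x y 1
  rw [inv_one, ofVertex_one, mul_one, map_one, one_smul, one_smul] at h1
  exact h1.2 h

/-- An incident edge group comes from a half-edge `(e, b)`, and the axis of this subgroup contains
the translate by `g` of the edge `xy` if and only if the corresponding edge of the Bass–Serre tree
belongs to `axisEdges T x y`. -/
theorem IsIncidentEdgeGroup.exists_halfEdge {v : V} {H : Subgroup (𝒢.VG v)}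
    (hH : 𝒢.IsIncidentEdgeGroup v H) {z : 𝒢.PathGroup} (hz : 𝒢.IsPath v₀ v z) (x y : T.X) :
    ∃ (e : E) (b : Bool), 𝒢.ends e b = v ∧ H ≍ (𝒢.incl e b).range ∧ ∀ g : 𝒢.VG v,
      (T.comap (conjHom hz)).OnAxis H.subtype (conjHom hz g • x) (conjHom hz g • y) ↔
        𝒢.edgeAt e b (z * 𝒢.ofVertex v g⁻¹) ∈ axisEdges T x y := by
  cases hH with
  | mk e b => exact ⟨e, b, rfl, HEq.rfl, onAxis_range_iff hz x y⟩

/-- If the axes of all two-ended subgroups of a vertex group contain `xy`, then all edges at the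
corresponding vertex of the Bass–Serre tree belong to `axisEdges T x y`. -/
theorem edgeAt_mem_axisEdges_of_forall (hedge : ∀ e : E, IsTwoEnded (𝒢.EG e)) {v : V}
    {z : 𝒢.PathGroup} (hz : 𝒢.IsPath v₀ v z) {x y : T.X}
    (h : ∀ H : Subgroup (𝒢.VG v), IsTwoEnded H → (T.comap (conjHom hz)).OnAxis H.subtype
      (conjHom hz 1 • x) (conjHom hz 1 • y)) {e : E} {b : Bool} (he : 𝒢.ends e b = v) :
    𝒢.edgeAt e b z ∈ axisEdges T x y := by
  subst he
  have := (onAxis_range_iff hz x y 1).1 (h _ ((IsIncidentEdgeGroup.mk e b).isTwoEnded hedge))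
  rwa [inv_one, ofVertex_one, mul_one] at this

theorem not_isOneEnded_of_splits {G : Type u} [Group G] {𝓗 : Set (Subgroup G)}
    (h : SplitsOverFiniteRel G 𝓗) : ¬ IsOneEnded G := by
  obtain ⟨T, h1, h2, -⟩ := h
  exact fun h => h.2 ⟨T, h1, h2, by simp⟩

/-- At a leaf of the forest of edges whose axes contain `xy`, either the vertex group is two-ended
and all its incident edge groups have the same axis, or the tree of lines is a splitting of the
vertex group relative to its incident edge groups. -/
theorem splits_of_leaf (hedge : ∀ e : E, IsTwoEnded (𝒢.EG e)) {e : E} {b : Bool}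
    {T : GTree (𝒢.VG (𝒢.ends e b))} (hT : T.FiniteEdgeStabilizers) {x y : T.X}
    (hxy : T.graph.Adj x y) (hax : T.OnAxis (𝒢.incl e b).range.subtype x y)
    (huniq : ∀ H, 𝒢.IsIncidentEdgeGroup (𝒢.ends e b) H → ∀ g,
      T.OnAxis H.subtype (g • x) (g • y) → H = (𝒢.incl e b).range ∧ g ∈ (𝒢.incl e b).range)
    (htwo : ¬ IsTwoEnded (𝒢.VG (𝒢.ends e b))) :
    IsInfiniteEnded (𝒢.VG (𝒢.ends e b)) ∧
      SplitsOverFiniteRel (𝒢.VG (𝒢.ends e b)) (𝒢.incidentEdgeGroups (𝒢.ends e b)) := by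
  have hC := (IsIncidentEdgeGroup.mk (𝒢 := 𝒢) e b).isTwoEnded hedge
  have hinf : Infinite (𝒢.VG (𝒢.ends e b)) := by
    have := hC.infinite
    exact Infinite.of_injective _ (𝒢.incl e b).range.subtype_injective
  have hsplit : SplitsOverFiniteRel (𝒢.VG (𝒢.ends e b)) (𝒢.incidentEdgeGroups (𝒢.ends e b)) := by
    refine hT.splits_of_onAxis hxy hC hax
      (fun g hg => (huniq _ (IsIncidentEdgeGroup.mk e b) g hg).2) htwo _ ?_
    intro H hH
    by_cases heq : H = (𝒢.incl e b).range
    · exact Or.inl heq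
    · exact Or.inr ⟨IsIncidentEdgeGroup.isTwoEnded hedge hH, fun g hg => heq (huniq H hH g hg).1⟩
  exact ⟨⟨hinf, not_isOneEnded_of_splits hsplit, htwo⟩, hsplit⟩

/-- If some edge group has no fixed vertex in the tree `T`, then take an edge `xy` on its axis. The
edges of the Bass–Serre tree whose axes contain `xy` form a finite forest, and at a leaf of this
forest the tree of lines is a splitting of the vertex group relative to its incident edge groups. -/
theorem exists_splits_of_not_elliptic [Finite E] (hedge : ∀ e : E, IsTwoEnded (𝒢.EG e))
    (htriv : ∀ v : V, ¬ 𝒢.IsTrivialVertex v) (hT : T.FiniteEdgeStabilizers) {e : E} {b : Bool}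
    {z : 𝒢.PathGroup} (hz : 𝒢.IsPath v₀ (𝒢.ends e b) z) (hell : ¬ T.Elliptic (edgeHom hz).range) :
    ∃ v, IsInfiniteEnded (𝒢.VG v) ∧ SplitsOverFiniteRel (𝒢.VG v) (𝒢.incidentEdgeGroups v) := by
  obtain ⟨x, y, hxy, hax⟩ := hT.exists_onAxis (hedge e) (edgeHom_injective hz) hell
  obtain ⟨e, b, z, hmem, hleaf⟩ := 𝒢.exists_forest_leaf (axisEdges T x y)
    (finite_axisEdges hedge hT hxy) ⟨_, (edgeAt_mem_axisEdges hz).2 hax⟩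
  clear hax hell hz
  have hz := isPath_of_edgeAt_mem hmem
  have hT' : (T.comap (conjHom hz)).FiniteEdgeStabilizers := hT.comap (conjHom_injective hz)
  have hax : (T.comap (conjHom hz)).OnAxis (𝒢.incl e b).range.subtype x y :=
    onAxis_range_of_mem hz hmem
  have huniq : ∀ H, 𝒢.IsIncidentEdgeGroup (𝒢.ends e b) H → ∀ g,
      (T.comap (conjHom hz)).OnAxis H.subtype (conjHom hz g • x) (conjHom hz g • y) →
        H = (𝒢.incl e b).range ∧ g ∈ (𝒢.incl e b).range := by
    intro H hH g hg
    obtain ⟨e', b', h1, h2, h3⟩ := IsIncidentEdgeGroup.exists_halfEdge hH hz x y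
    obtain ⟨rfl, rfl, h4⟩ := hleaf e' b' h1 _ ((h3 g).1 hg)
    exact ⟨eq_of_heq h2, inv_mem_iff.1 h4⟩
  refine ⟨_, splits_of_leaf hedge hT' hxy hax huniq fun h2 => ?_⟩
  -- otherwise all edges at this vertex have the same axis, so that it is a trivial vertex
  have hH : ∀ H : Subgroup (𝒢.VG (𝒢.ends e b)), IsTwoEnded H → ∀ g,
      (T.comap (conjHom hz)).OnAxis H.subtype (conjHom hz g • x) (conjHom hz g • y) := by
    intro H hH g
    have := hH.infinite
    exact hT'.onAxis_of_isTwoEnded h2 hxy hax H g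
  refine htriv _ ⟨e, b, rfl, fun e' b' h' => ?_, fun g => ?_⟩
  · have h3 := edgeAt_mem_axisEdges_of_forall hedge hz (fun H h => hH H h 1) h'
    have h4 := hleaf e' b' h' 1 (by rwa [ofVertex_one, mul_one])
    exact ⟨h4.1, h4.2.1⟩
  · have hC := IsIncidentEdgeGroup.mk (𝒢 := 𝒢) e b
    exact (huniq _ hC g (hH _ (hC.isTwoEnded hedge) g)).2

end GraphOfGroups

/-! ### One-endedness of the fundamental group -/

theorem SplitsOverFiniteRel.of_equiv {G H : Type u} [Group G] [Group H] (f : H ≃* G)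
    (h : SplitsOverFiniteRel G ∅) : SplitsOverFiniteRel H ∅ := by
  obtain ⟨T, h1, h2, -⟩ := h
  refine ⟨T.comap f.toMonoidHom, GTree.nontrivial_of_not_elliptic_top ?_, h2.comap f.injective,
    by simp⟩
  rw [GTree.comap_elliptic_iff, Subgroup.map_top_of_surjective _ f.surjective]
  exact h1.not_elliptic_top

theorem IsOneEnded.of_equiv {G H : Type u} [Group G] [Group H] (f : H ≃* G) (h : IsOneEnded G) :
    IsOneEnded H := by
  have := h.1
  exact ⟨Infinite.of_injective _ f.symm.injective, fun hs => h.2 (hs.of_equiv f.symm)⟩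

namespace GraphOfGroups

variable {V E : Type u} {𝒢 : GraphOfGroups V E} {v₀ : V}

theorem range_edgeHom_le {e : E} {b : Bool} {z : 𝒢.PathGroup}
    (hz : 𝒢.IsPath v₀ (𝒢.ends e b) z) : (edgeHom hz).range = (𝒢.incl e b).range.map (conjHom hz) :=
  MonoidHom.range_comp _ _

/-- If all edge groups fix a vertex of a tree with finite edge stabilisers, then so does every
vertex group, unless some vertex group splits relative to its incident edge groups. -/
theorem exists_fixed_of_elliptic (hedge : ∀ e : E, IsTwoEnded (𝒢.EG e))
    {T : GTree (𝒢.fundamentalGroup v₀)} (hT : T.FiniteEdgeStabilizers)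
    (hell : ∀ (e : E) (b : Bool) (z : 𝒢.PathGroup) (hz : 𝒢.IsPath v₀ (𝒢.ends e b) z),
      T.Elliptic (edgeHom hz).range)
    (hsplit : ∀ v : V, IsInfiniteEnded (𝒢.VG v) →
      ¬ SplitsOverFiniteRel (𝒢.VG v) (𝒢.incidentEdgeGroups v))
    (e : E) (b : Bool) {z : 𝒢.PathGroup} (hz : 𝒢.IsPath v₀ (𝒢.ends e b) z) :
    ∃ p : T.X, ∀ g, conjHom hz g • p = p := by
  have hinf : Infinite (𝒢.EG e) := (hedge e).infinite
  by_contra hno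
  have htop : ¬ (T.comap (conjHom hz)).Elliptic ⊤ := by
    rintro ⟨p, hp⟩
    exact hno ⟨p, fun g => hp (Subgroup.mem_top g)⟩
  have hT' : (T.comap (conjHom hz)).FiniteEdgeStabilizers := hT.comap (conjHom_injective hz)
  have hinc : ∀ v (z : 𝒢.PathGroup) (hz : 𝒢.IsPath v₀ v z) (H : Subgroup (𝒢.VG v)),
      𝒢.IsIncidentEdgeGroup v H → (T.comap (conjHom hz)).Elliptic H := by
    intro v z hz H hH
    cases hH with
    | mk e b =>
      rw [GTree.comap_elliptic_iff, ← range_edgeHom_le]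
      exact hell e b z hz
  have hone : ¬ IsOneEnded (𝒢.VG (𝒢.ends e b)) := fun h =>
    h.2 ⟨_, GTree.nontrivial_of_not_elliptic_top htop, hT', by simp⟩
  have hrange : Infinite (𝒢.incl e b).range :=
    Infinite.of_injective _ (MonoidHom.ofInjective (𝒢.incl_injective e b)).injective
  have htwo : ¬ IsTwoEnded (𝒢.VG (𝒢.ends e b)) := by
    intro h
    have := h.finiteIndex_of_infinite (𝒢.incl e b).range
    obtain ⟨p, hp⟩ := hinc _ z hz _ (IsIncidentEdgeGroup.mk e b)
    have h1 := (T.comap (conjHom hz)).elliptic_of_finiteIndex (MonoidHom.id _) _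
      (p := p) (fun k hk => hp hk)
    rw [MonoidHom.range_eq_top.2 Function.surjective_id] at h1
    exact htop h1
  exact hsplit _ ⟨Infinite.of_injective _ (𝒢.incl_injective e b), hone, htwo⟩
    ⟨_, GTree.nontrivial_of_not_elliptic_top htop, hT', fun H hH => hinc _ z hz H hH⟩

/-- The vertices fixed by the groups at the two ends of an edge agree, since both are fixed by the
infinite edge group. Hence there is a common fixed vertex. -/
theorem fixed_of_isPath (hedge : ∀ e : E, IsTwoEnded (𝒢.EG e))
    {T : GTree (𝒢.fundamentalGroup v₀)} (hT : T.FiniteEdgeStabilizers)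
    (hfix : ∀ (e : E) (b : Bool) (z : 𝒢.PathGroup) (hz : 𝒢.IsPath v₀ (𝒢.ends e b) z),
      ∃ p : T.X, ∀ g, conjHom hz g • p = p)
    {p : T.X} (hp : ∀ g, conjHom (𝒢 := 𝒢) (IsPath.nil (v := v₀)) g • p = p)
    {v : V} {z : 𝒢.PathGroup} (hz : 𝒢.IsPath v₀ v z) (g : 𝒢.VG v) : conjHom hz g • p = p := by
  have hstep : ∀ (e : E) (b b' : Bool) (z : 𝒢.PathGroup) (hz : 𝒢.IsPath v₀ (𝒢.ends e b) z)
      (z' : 𝒢.PathGroup) (hz' : 𝒢.IsPath v₀ (𝒢.ends e b') z'),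
      z * 𝒢.halfEdge e b = z' * 𝒢.halfEdge e b' → (∀ g, conjHom hz g • p = p) →
      ∀ g, conjHom hz' g • p = p := by
    intro e b b' z hz z' hz' h h1
    obtain ⟨q, hq⟩ := hfix e b' z' hz'
    have h2 : edgeHom hz = edgeHom hz' := by
      rw [← edgeHom_mul_halfEdge, ← edgeHom_mul_halfEdge hz']
      simp only [h]
    have hpq : p = q := by
      by_contra hne
      have h3 := hT.finite_of_fixes (edgeHom_injective hz') (p := p) (q := q)
        (fun c => by rw [← h2]; exact h1 _) (fun c => hq _) hne
      exact not_finite_iff_infinite.2 (hedge e).infinite h3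
    rw [hpq]
    exact hq
  induction hz with
  | nil => exact hp g
  | vertex hz h ih =>
    convert ih (h * g * h⁻¹) using 2
    refine Subtype.ext ?_
    simp [conjHom_coe, mul_assoc]
  | edge e hz ih =>
    exact hstep e false true _ hz _ (hz.edge e) (by simp [halfEdge]) ih g
  | edgeInv e hz ih =>
    exact hstep e true false _ hz _ (hz.edgeInv e) (by simp [halfEdge]) ih g

/-- If no infinite-ended vertex group splits relative to its incident edge groups, then every tree
of the fundamental group with finite edge stabilisers has a fixed vertex. -/
theorem not_nontrivial_of_not_splits [Finite E] [Nonempty E] (hconn : 𝒢.Connected)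
    (hedge : ∀ e : E, IsTwoEnded (𝒢.EG e)) (htriv : ∀ v : V, ¬ 𝒢.IsTrivialVertex v)
    (hsplit : ∀ v : V, IsInfiniteEnded (𝒢.VG v) →
      ¬ SplitsOverFiniteRel (𝒢.VG v) (𝒢.incidentEdgeGroups v))
    {T : GTree (𝒢.fundamentalGroup v₀)} (hT : T.FiniteEdgeStabilizers) : ¬ T.Nontrivial := by
  have hell : ∀ (e : E) (b : Bool) (z : 𝒢.PathGroup) (hz : 𝒢.IsPath v₀ (𝒢.ends e b) z),
      T.Elliptic (edgeHom hz).range := by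
    intro e b z hz
    by_contra h
    obtain ⟨v, h1, h2⟩ := exists_splits_of_not_elliptic hedge htriv hT hz h
    exact hsplit v h1 h2
  have hfix := fun e b z (hz : 𝒢.IsPath v₀ (𝒢.ends e b) z) =>
    exists_fixed_of_elliptic hedge hT hell hsplit e b hz
  -- as the graph is connected and has an edge, some edge is incident to the base vertex
  obtain ⟨e, b, rfl⟩ : ∃ (e : E) (b : Bool), 𝒢.ends e b = v₀ := by
    obtain ⟨e₁⟩ := ‹Nonempty E›
    obtain ⟨p⟩ := SimpleGraph.Connected.preconnected hconn v₀ (𝒢.ends e₁ false)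
    cases p with
    | nil => exact ⟨e₁, false, rfl⟩
    | cons hadj _ =>
      obtain ⟨-, ⟨e, h, -⟩ | ⟨e, -, h⟩⟩ := (SimpleGraph.fromRel_adj _ _ _).1 hadj
      · exact ⟨e, false, h⟩
      · exact ⟨e, true, h⟩
  obtain ⟨p, hp⟩ := hfix e b 1 IsPath.nil
  intro hnt
  refine hnt p (eq_top_iff.2 fun γ _ => ?_)
  rw [MulAction.mem_stabilizer_iff]
  have hγ : 𝒢.IsPath (𝒢.ends e b) (𝒢.ends e b) γ := γ.2
  have h1 := fixed_of_isPath hedge hT hfix hp hγ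
  have h2 : ∀ g, conjHom (𝒢 := 𝒢) (IsPath.nil (v := 𝒢.ends e b)) g • γ⁻¹ • p = γ⁻¹ • p := by
    intro g
    rw [← mul_smul, eq_inv_smul_iff, ← mul_smul]
    convert h1 g using 2
    refine Subtype.ext ?_
    simp [conjHom_coe, mul_assoc]
  by_contra hne
  have h3 := hT.finite_of_fixes (conjHom_injective IsPath.nil) hp h2
    (fun h => hne (smul_eq_iff_eq_inv_smul γ |>.2 h))
  have h4 : Infinite (𝒢.EG e) := (hedge e).infinite
  have h5 := Infinite.of_injective _ (𝒢.incl_injective e b)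
  exact not_finite_iff_infinite.2 h5 h3

theorem infinite_fundamentalGroup [Nonempty E] (hconn : 𝒢.Connected)
    (hedge : ∀ e : E, IsTwoEnded (𝒢.EG e)) : Infinite (𝒢.fundamentalGroup v₀) := by
  obtain ⟨e⟩ := ‹Nonempty E›
  obtain ⟨z, hz⟩ := hconn.exists_isPath v₀ (𝒢.ends e false)
  have := (hedge e).infinite
  exact Infinite.of_injective _ (edgeHom_injective hz)

/-- The fundamental group of a graph of groups without edges is its vertex group. -/
noncomputable def equivOfIsEmpty [IsEmpty E] : 𝒢.VG v₀ ≃* 𝒢.fundamentalGroup v₀ :=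
  MulEquiv.ofBijective (conjHom IsPath.nil) ⟨conjHom_injective _, by
    have key : ∀ v z, 𝒢.IsPath v₀ v z → v = v₀ ∧ ∃ g : 𝒢.VG v₀, z = 𝒢.ofVertex v₀ g := by
      intro v z hz
      induction hz with
      | nil => exact ⟨rfl, 1, (𝒢.ofVertex_one v₀).symm⟩
      | vertex _ h ih =>
        obtain ⟨rfl, g, rfl⟩ := ih
        exact ⟨rfl, g * h, (𝒢.ofVertex_mul _ g h).symm⟩
      | edge e => exact isEmptyElim e
      | edgeInv e => exact isEmptyElim e
    rintro ⟨z, hz⟩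
    obtain ⟨-, g, rfl⟩ := key _ _ hz
    exact ⟨g, Subtype.ext (by simp [conjHom_coe])⟩⟩

end GraphOfGroups

/-! ### Blowing up a vertex -/

namespace GraphOfGroups

variable {V E : Type u} {𝒢 : GraphOfGroups V E} {v : V}

/-- The pairs of vertices in the translates, under the path group, of a tree on which a vertex group
acts. The translates are indexed by all elements of the path group, so that the translate by `x` and
that by `x * g`, for `g` in the vertex group, are copies of one another. -/
def BlowUpIndex (T : GTree (𝒢.VG v)) : Type u := 𝒢.PathGroup × T.X × T.X

instance (T : GTree (𝒢.VG v)) : MulAction 𝒢.PathGroup (BlowUpIndex T) where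
  smul x a := (x * a.1, a.2)
  one_smul _ := Prod.ext (one_mul _) rfl
  mul_smul _ _ _ := Prod.ext (mul_assoc _ _ _) rfl

open Classical in
/-- The vertex `y` of the tree as a function: it takes the value one on those pairs of vertices that
cut off a half-tree to which `y` belongs. -/
noncomputable def side {T : GTree (𝒢.VG v)} (y : T.X) : Cochain (BlowUpIndex T) := fun a =>
  if ∃ g : 𝒢.VG v, a.1 = 𝒢.ofVertex v g ∧ y ∈ T.half (g • a.2.1) (g • a.2.2) then 1 else 0

variable {T : GTree (𝒢.VG v)}

theorem smul_side (g : 𝒢.VG v) (y : T.X) : 𝒢.ofVertex v g • side y = side (g • y) := by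
  funext a
  rw [Cochain.smul_apply]
  have h : (∃ h : 𝒢.VG v, ((𝒢.ofVertex v g)⁻¹ • a).1 = 𝒢.ofVertex v h ∧
      y ∈ T.half (h • ((𝒢.ofVertex v g)⁻¹ • a).2.1) (h • ((𝒢.ofVertex v g)⁻¹ • a).2.2)) ↔
      ∃ h : 𝒢.VG v, a.1 = 𝒢.ofVertex v h ∧ g • y ∈ T.half (h • a.2.1) (h • a.2.2) := by
    change (∃ h : 𝒢.VG v, (𝒢.ofVertex v g)⁻¹ * a.1 = 𝒢.ofVertex v h ∧
      y ∈ T.half (h • a.2.1) (h • a.2.2)) ↔ _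
    constructor
    · rintro ⟨h, h1, h2⟩
      refine ⟨g * h, ?_, ?_⟩
      · rw [ofVertex_mul, ← h1, mul_inv_cancel_left]
      · rw [mul_smul, mul_smul, T.smul_mem_half]
        exact h2
    · rintro ⟨h, h1, h2⟩
      refine ⟨g⁻¹ * h, ?_, ?_⟩
      · rw [ofVertex_mul, ← ofVertex_inv, h1]
      · rw [mul_smul, mul_smul, ← T.smul_mem_half_iff]
        exact h2
  classical
  exact if_congr h rfl rfl

theorem side_ofVertex (y u w : T.X) (g : 𝒢.VG v) :
    side y (𝒢.ofVertex v g, u, w) = 1 ↔ y ∈ T.half (g • u) (g • w) := by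
  have h : (∃ h : 𝒢.VG v, 𝒢.ofVertex v g = 𝒢.ofVertex v h ∧ y ∈ T.half (h • u) (h • w)) ↔
      y ∈ T.half (g • u) (g • w) := by
    constructor
    · rintro ⟨h, h1, h2⟩
      rwa [𝒢.ofVertex_injective v h1]
    · exact fun h => ⟨g, rfl, h⟩
  simp [side, h]

theorem side_eq_iff (y y' u w : T.X) (g : 𝒢.VG v) :
    side y (𝒢.ofVertex v g, u, w) = side y' (𝒢.ofVertex v g, u, w) ↔
      (y ∈ T.half (g • u) (g • w) ↔ y' ∈ T.half (g • u) (g • w)) := by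
  rw [← side_ofVertex, ← side_ofVertex]
  generalize side y (𝒢.ofVertex v g, u, w) = a
  generalize side y' (𝒢.ofVertex v g, u, w) = b
  revert a b
  decide

theorem side_eq_of_notMem {x : 𝒢.PathGroup} (hx : ¬ ∃ g, x = 𝒢.ofVertex v g) (y y' u w : T.X) :
    side y (x, u, w) = side y' (x, u, w) := by
  have h : ∀ y : T.X, ¬ ∃ g : 𝒢.VG v, x = 𝒢.ofVertex v g ∧ y ∈ T.half (g • u) (g • w) :=
    fun y ⟨g, hg, _⟩ => hx ⟨g, hg⟩
  simp [side, h]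

/-- A derivation of the path group that describes the blow-up of the graph of groups at the
vertex `v`, with the edges of the graph of groups collapsed: it is trivial on the vertex groups, and
on the stable letter of an edge it is given by the points to which the two ends of the edge are
attached. -/
structure BlowUp (T : GTree (𝒢.VG v)) where
  /-- the derivation -/
  d : 𝒢.PathGroup → Cochain (BlowUpIndex T)
  map_mul : ∀ x y, d (x * y) = d x + x • d y
  map_ofVertex : ∀ w g, d (𝒢.ofVertex w g) = 0
  /-- the points to which the ends of the edges are attached -/
  q : E → Bool → Cochain (BlowUpIndex T)
  q_of_eq : ∀ e b, 𝒢.ends e b = v → ∃ p : T.X, q e b = side p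
  q_of_ne : ∀ e b, 𝒢.ends e b ≠ v → q e b = 0
  map_ofEdge : ∀ e, d (𝒢.ofEdge e) = q e false - 𝒢.ofEdge e • q e true

/-- If the incident edge groups are elliptic in a tree of the vertex group, then the edges of the
graph of groups can be attached to points of the tree. -/
theorem exists_blowUp (hell : ∀ H ∈ 𝒢.incidentEdgeGroups v, T.Elliptic H) : Nonempty (BlowUp T) := by
  have hq : ∀ (e : E) (b : Bool), ∃ q : Cochain (BlowUpIndex T),
      (∀ a, 𝒢.ofVertex _ (𝒢.incl e b a) • q = q) ∧
      (𝒢.ends e b = v → ∃ p : T.X, q = side p) ∧ (𝒢.ends e b ≠ v → q = 0) := by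
    intro e b
    by_cases h : 𝒢.ends e b = v
    · subst h
      obtain ⟨p, hp⟩ := hell _ (IsIncidentEdgeGroup.mk e b)
      refine ⟨side p, fun a => ?_, fun _ => ⟨p, rfl⟩, fun h => absurd rfl h⟩
      rw [smul_side, hp ⟨a, rfl⟩]
    · exact ⟨0, fun a => smul_zero _, fun h' => absurd h' h, fun _ => rfl⟩
  choose q hq1 hq2 hq3 using hq
  obtain ⟨d, h1, h2, h3⟩ := 𝒢.exists_derivation (M := Cochain (BlowUpIndex T)) (fun _ _ => 0)
    (by simp) (fun e => q e false - 𝒢.ofEdge e • q e true) (by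
      intro e a
      rw [smul_zero, add_zero, zero_add, smul_sub, hq1, ← mul_smul, ← ofEdge_mul_ofVertex,
        mul_smul, hq1])
  exact ⟨⟨d, h1, h2, q, hq2, hq3, h3⟩⟩

namespace BlowUp

variable (B : BlowUp T)

theorem map_one : B.d 1 = 0 := by
  have h := B.map_ofVertex v 1
  rwa [ofVertex_one] at h

/-- The vertex that corresponds to `y` in the translate of the tree by `x`. -/
noncomputable def point (x : 𝒢.PathGroup) (y : T.X) : Cochain (BlowUpIndex T) :=
  B.d x + x • side y

theorem point_mul_ofVertex (x : 𝒢.PathGroup) (g : 𝒢.VG v) (y : T.X) :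
    B.point (x * 𝒢.ofVertex v g) y = B.point x (g • y) := by
  rw [point, point, B.map_mul, B.map_ofVertex, smul_zero, add_zero, mul_smul, smul_side]

theorem point_mul (x x' : 𝒢.PathGroup) (y : T.X) :
    B.d x + x • B.point x' y = B.point (x * x') y := by
  rw [point, point, B.map_mul, smul_add, mul_smul, add_assoc]

theorem point_apply (x x' : 𝒢.PathGroup) (y u w : T.X) :
    B.point x y (x', u, w) = B.d x (x', u, w) + side y (x⁻¹ * x', u, w) := rfl

theorem point_apply_eq_iff (x : 𝒢.PathGroup) (g : 𝒢.VG v) (y y' u w : T.X) :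
    B.point x y (x * 𝒢.ofVertex v g, u, w) = B.point x y' (x * 𝒢.ofVertex v g, u, w) ↔
      (y ∈ T.half (g • u) (g • w) ↔ y' ∈ T.half (g • u) (g • w)) := by
  rw [point_apply, point_apply, inv_mul_cancel_left, add_right_inj]
  exact side_eq_iff y y' u w g

theorem point_apply_self_ne (x : 𝒢.PathGroup) {u w : T.X} (h : T.graph.Adj u w) :
    B.point x u (x, u, w) ≠ B.point x w (x, u, w) := by
  have h1 := B.point_apply_eq_iff x 1 u w u w
  rw [ofVertex_one, mul_one, one_smul, one_smul] at h1
  rw [ne_eq, h1]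
  exact fun h2 => SimpleGraph.source_notMem_halfTree (h2.2 (T.isTree.target_mem_halfTree h))

theorem point_injective (x : 𝒢.PathGroup) : Function.Injective (B.point x) := by
  intro y y' h
  by_contra hne
  obtain ⟨w, hw, hy'⟩ := T.isTree.connected.exists_adj_dist_lt hne
  have h1 := B.point_apply_eq_iff x 1 y y' y w
  rw [ofVertex_one, mul_one, one_smul, one_smul, h] at h1
  exact SimpleGraph.source_notMem_halfTree ((h1.1 rfl).2 hy')

/-- Only the copies of the edge `uw` have different values on the pair `(u, w)`. -/
theorem exists_of_point_apply_ne {x x' : 𝒢.PathGroup} {y y' u w : T.X} (hy : T.graph.Adj y y')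
    (hu : T.graph.Adj u w) (h : B.point x y (x', u, w) ≠ B.point x y' (x', u, w)) :
    ∃ g, x' = x * 𝒢.ofVertex v g ∧ s(y, y') = s(g • u, g • w) := by
  by_cases hx : ∃ g, x⁻¹ * x' = 𝒢.ofVertex v g
  · obtain ⟨g, hg⟩ := hx
    obtain rfl : x' = x * 𝒢.ofVertex v g := by rw [← hg, mul_inv_cancel_left]
    refine ⟨g, rfl, ?_⟩
    by_contra hne
    rw [ne_eq, point_apply_eq_iff] at h
    exact h (T.isTree.mem_halfTree_iff_of_adj (T.adj_smul g _ _ hu) hy hne)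
  · exfalso
    apply h
    rw [point_apply, point_apply, side_eq_of_notMem hx y y']

/-- The vertices of the tree obtained from the blow-up. -/
abbrev Vertex : Type u :=
  {m : Cochain (BlowUpIndex T) // ∃ x, 𝒢.IsPath v v x ∧ ∃ y : T.X, m = B.point x y}

instance : MulAction (𝒢.fundamentalGroup v) B.Vertex where
  smul γ m := ⟨B.d γ + (γ : 𝒢.PathGroup) • m.1, by
    obtain ⟨x, hx, y, hy⟩ := m.2
    exact ⟨γ * x, IsPath.trans γ.2 hx, y, by rw [hy, point_mul]⟩⟩
  one_smul m := Subtype.ext (by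
    change B.d 1 + (1 : 𝒢.PathGroup) • m.1 = m.1
    rw [B.map_one, one_smul, zero_add])
  mul_smul γ γ' m := Subtype.ext (by
    change B.d (γ * γ') + (γ * γ' : 𝒢.PathGroup) • m.1 =
      B.d γ + (γ : 𝒢.PathGroup) • (B.d γ' + (γ' : 𝒢.PathGroup) • m.1)
    rw [B.map_mul, smul_add, mul_smul, add_assoc])

/-- A point of a translate by an element of the fundamental group, as a vertex. -/
noncomputable def vertex {x : 𝒢.PathGroup} (hx : 𝒢.IsPath v v x) (y : T.X) : B.Vertex :=
  ⟨B.point x y, x, hx, y, rfl⟩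

theorem smul_vertex (γ : 𝒢.fundamentalGroup v) {x : 𝒢.PathGroup} (hx : 𝒢.IsPath v v x) (y : T.X) :
    γ • B.vertex hx y = B.vertex (IsPath.trans γ.2 hx) y :=
  Subtype.ext (B.point_mul γ x y)

/-- The graph whose edges are the translates of the edges of `T`. -/
def graph : SimpleGraph B.Vertex where
  Adj m m' := ∃ (x : 𝒢.PathGroup) (hx : 𝒢.IsPath v v x) (y y' : T.X), T.graph.Adj y y' ∧
    m = B.vertex hx y ∧ m' = B.vertex hx y'
  symm.symm := by
    rintro _ _ ⟨x, hx, y, y', h, rfl, rfl⟩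
    exact ⟨x, hx, y', y, h.symm, rfl, rfl⟩
  loopless.irrefl := by
    rintro _ ⟨x, hx, y, y', h, rfl, h'⟩
    exact h.ne (B.point_injective x (congrArg Subtype.val h'))

theorem isAcyclic_graph : B.graph.IsAcyclic := by
  refine SimpleGraph.isAcyclic_of_cuts (α := ZMod 2) ?_
  rintro _ _ ⟨x, hx, u, w, h, rfl, rfl⟩
  refine ⟨fun m => m.1 (x, u, w), B.point_apply_self_ne x h, ?_⟩
  rintro _ _ ⟨x₁, hx₁, y, y', h', rfl, rfl⟩ hne
  by_contra hdiff
  obtain ⟨g, rfl, hg⟩ := B.exists_of_point_apply_ne h' h hdiff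
  have h1 : ∀ z : T.X, B.vertex hx z = B.vertex hx₁ (g • z) := fun z =>
    Subtype.ext (B.point_mul_ofVertex x₁ g z)
  apply hne
  rw [h1, h1]
  rcases Sym2.eq_iff.1 hg with ⟨rfl, rfl⟩ | ⟨rfl, rfl⟩
  · rfl
  · exact Sym2.eq_swap

theorem reachable_vertex {x : 𝒢.PathGroup} (hx : 𝒢.IsPath v v x) (y y' : T.X) :
    B.graph.Reachable (B.vertex hx y) (B.vertex hx y') := by
  obtain ⟨p⟩ := T.isTree.connected y y'
  induction p with
  | nil => exact SimpleGraph.Reachable.refl _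
  | cons hadj _ ih =>
    exact SimpleGraph.Reachable.trans (SimpleGraph.Adj.reachable ⟨x, hx, _, _, hadj, rfl, rfl⟩) ih

theorem connected_graph : B.graph.Connected := by
  obtain ⟨y₀⟩ := T.isTree.connected.nonempty
  -- the points of the blow-up that lie over the vertex `w` are those of the form `d x + x • q`
  let Over : V → Cochain (BlowUpIndex T) → Prop := fun w q =>
    (w = v → ∃ p : T.X, q = side p) ∧ (w ≠ v → q = 0)
  let Reach : Cochain (BlowUpIndex T) → Prop := fun m =>
    ∃ m' : B.Vertex, m'.1 = m ∧ B.graph.Reachable (B.vertex IsPath.nil y₀) m'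
  have hOver : ∀ e b, Over (𝒢.ends e b) (B.q e b) := fun e b => ⟨B.q_of_eq e b, B.q_of_ne e b⟩
  have hmove : ∀ w x q q', 𝒢.IsPath v w x → Over w q → Over w q' → Reach (B.d x + x • q) →
      Reach (B.d x + x • q') := by
    intro w x q q' hx hq hq' hr
    by_cases hw : w = v
    · subst hw
      obtain ⟨p, rfl⟩ := hq.1 rfl
      obtain ⟨p', rfl⟩ := hq'.1 rfl
      obtain ⟨m, hm, hr⟩ := hr
      obtain rfl : m = B.vertex hx p := Subtype.ext hm
      exact ⟨B.vertex hx p', rfl, hr.trans (B.reachable_vertex hx p p')⟩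
    · rwa [hq'.2 hw, ← hq.2 hw]
  have key : ∀ w x, 𝒢.IsPath v w x → ∀ q, Over w q → Reach (B.d x + x • q) := by
    intro w x hx
    induction hx with
    | nil =>
      intro q hq
      obtain ⟨p, rfl⟩ := hq.1 rfl
      exact ⟨B.vertex IsPath.nil p, rfl, B.reachable_vertex IsPath.nil y₀ p⟩
    | @vertex w x hx g ih =>
      intro q hq
      rw [B.map_mul, B.map_ofVertex, smul_zero, add_zero, mul_smul]
      refine ih _ ⟨?_, fun h => by rw [hq.2 h, smul_zero]⟩
      rintro rfl
      obtain ⟨p, rfl⟩ := hq.1 rfl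
      exact ⟨g • p, smul_side g p⟩
    | @edge x e hx ih =>
      intro q hq
      refine hmove _ _ _ _ (hx.edge e) (hOver e true) hq ?_
      have h := ih _ (hOver e false)
      rwa [B.map_mul, B.map_ofEdge, smul_sub, mul_smul, add_assoc, sub_add_cancel]
    | @edgeInv x e hx ih =>
      intro q hq
      refine hmove _ _ _ _ (hx.edgeInv e) (hOver e false) hq ?_
      have h := ih _ (hOver e true)
      have h1 : B.d x = B.d (x * (𝒢.ofEdge e)⁻¹) +
          (x * (𝒢.ofEdge e)⁻¹) • (B.q e false - 𝒢.ofEdge e • B.q e true) := by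
        rw [← B.map_ofEdge, ← B.map_mul, inv_mul_cancel_right]
      rwa [h1, smul_sub, ← mul_smul _ (𝒢.ofEdge e), inv_mul_cancel_right, add_assoc,
        sub_add_cancel] at h
  refine (SimpleGraph.connected_iff_exists_forall_reachable _).2 ⟨B.vertex IsPath.nil y₀, ?_⟩
  rintro ⟨_, x, hx, y, rfl⟩
  obtain ⟨m, hm, hr⟩ := key v x hx (side y) ⟨fun _ => ⟨y, rfl⟩, fun h => absurd rfl h⟩
  obtain rfl : m = B.vertex hx y := Subtype.ext hm
  exact hr

theorem exists_of_smul_vertex_ne {γ : 𝒢.fundamentalGroup v} {x : 𝒢.PathGroup}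
    (hx : 𝒢.IsPath v v x) {y y' : T.X} (h : T.graph.Adj y y')
    (hne : (γ • B.vertex hx y).1 (x, y, y') ≠ (γ • B.vertex hx y').1 (x, y, y')) :
    ∃ g : 𝒢.VG v, (γ : 𝒢.PathGroup) = x * 𝒢.ofVertex v g * x⁻¹ ∧
      ∀ z, γ • B.vertex hx z = B.vertex hx (g • z) := by
  rw [smul_vertex, smul_vertex] at hne
  obtain ⟨g, hg, -⟩ := B.exists_of_point_apply_ne h h hne
  have h1 : (γ : 𝒢.PathGroup) * x = x * 𝒢.ofVertex v g⁻¹ := by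
    rw [← ofVertex_inv, eq_mul_inv_iff_mul_eq]
    exact hg.symm
  refine ⟨g⁻¹, ?_, fun z => ?_⟩
  · rw [← h1, mul_inv_cancel_right]
  · rw [smul_vertex]
    refine Subtype.ext ?_
    change B.point (γ * x) z = B.point x (g⁻¹ • z)
    rw [h1, point_mul_ofVertex]

/-- The tree of the fundamental group obtained by blowing up the vertex `v` of the Bass–Serre tree
to the tree `T` of the vertex group, and collapsing the edges of the Bass–Serre tree. -/
def tree : GTree (𝒢.fundamentalGroup v) where
  X := B.Vertex
  graph := B.graph
  isTree := ⟨B.connected_graph, B.isAcyclic_graph⟩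
  adj_smul := by
    rintro γ _ _ ⟨x, hx, y, y', h, rfl, rfl⟩
    exact ⟨γ * x, IsPath.trans γ.2 hx, y, y', h, B.smul_vertex γ hx y, B.smul_vertex γ hx y'⟩
  no_inversion := by
    rintro γ _ _ ⟨x, hx, y, y', h, rfl, rfl⟩ ⟨h1, h2⟩
    obtain ⟨g, -, hg⟩ := B.exists_of_smul_vertex_ne (γ := γ) hx h (by
      rw [h1, h2]
      exact (B.point_apply_self_ne x h).symm)
    rw [hg] at h1 h2
    exact T.no_inversion g y y' h ⟨B.point_injective x (congrArg Subtype.val h1),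
      B.point_injective x (congrArg Subtype.val h2)⟩

theorem tree_nontrivial (hT : T.Nontrivial) : B.tree.Nontrivial := by
  rintro ⟨_, x, hx, y, rfl⟩ hfix
  refine hT y (eq_top_iff.2 fun g _ => B.point_injective x ?_)
  have h1 := hfix.ge (Subgroup.mem_top (conjHom hx g))
  have h2 := congrArg Subtype.val
    ((B.smul_vertex (conjHom hx g) hx y).symm.trans (show _ = B.vertex hx y from h1))
  have h3 : B.point (x * 𝒢.ofVertex v g * x⁻¹ * x) y = B.point x y := h2
  rwa [inv_mul_cancel_right, point_mul_ofVertex] at h3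

theorem tree_finiteEdgeStabilizers (hT : T.FiniteEdgeStabilizers) :
    B.tree.FiniteEdgeStabilizers := by
  rintro _ _ ⟨x, hx, y, y', h, rfl, rfl⟩
  have := hT y y' h
  refine Set.Finite.to_subtype (s := (B.tree.edgeStabilizer (B.vertex hx y) (B.vertex hx y') :
    Set (𝒢.fundamentalGroup v))) ?_
  refine (Set.toFinite (conjHom hx '' (T.edgeStabilizer y y' : Set (𝒢.VG v)))).subset ?_
  rintro γ ⟨h1, h2⟩
  have h1 : γ • B.vertex hx y = B.vertex hx y := h1
  have h2 : γ • B.vertex hx y' = B.vertex hx y' := h2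
  obtain ⟨g, hγ, hg⟩ := B.exists_of_smul_vertex_ne (γ := γ) hx h (by
    rw [h1, h2]
    exact B.point_apply_self_ne x h)
  rw [hg] at h1 h2
  exact ⟨g, ⟨B.point_injective x (congrArg Subtype.val h1),
    B.point_injective x (congrArg Subtype.val h2)⟩, Subtype.ext hγ.symm⟩

end BlowUp

/-- A splitting of a vertex group relative to its incident edge groups gives a splitting of the
fundamental group. -/
theorem splits_of_vertexGroup_splits
    (h : SplitsOverFiniteRel (𝒢.VG v) (𝒢.incidentEdgeGroups v)) :
    SplitsOverFiniteRel (𝒢.fundamentalGroup v) ∅ := by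
  obtain ⟨T, h1, h2, h3⟩ := h
  obtain ⟨B⟩ := exists_blowUp h3
  exact ⟨B.tree, B.tree_nontrivial h1, B.tree_finiteEdgeStabilizers h2, by simp⟩

/-- The fundamental groups at two base vertices are isomorphic. -/
def fundamentalGroupEquiv {v w : V} {x : 𝒢.PathGroup} (hx : 𝒢.IsPath v w x) :
    𝒢.fundamentalGroup v ≃* 𝒢.fundamentalGroup w where
  toFun γ := ⟨x⁻¹ * γ * x, IsPath.trans (IsPath.trans hx.symm γ.2) hx⟩
  invFun γ := ⟨x * γ * x⁻¹, IsPath.trans (IsPath.trans hx γ.2) hx.symm⟩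
  left_inv γ := Subtype.ext (by simp [mul_assoc])
  right_inv γ := Subtype.ext (by simp [mul_assoc])
  map_mul' γ γ' := Subtype.ext (by simp [mul_assoc])

end GraphOfGroups

theorem theorem2p3 {V E : Type u} [Finite V] [Finite E] (𝒢 : GraphOfGroups V E)
    (hconn : 𝒢.Connected) (v₀ : V)
    (Γ : Type u) [Group Γ] (φ : Γ ≃* 𝒢.fundamentalGroup v₀)
    (hedge : ∀ e : E, IsTwoEnded (𝒢.EG e))
    (htriv : ∀ v : V, ¬ 𝒢.IsTrivialVertex v)
    (hpoint : IsEmpty E → Infinite Γ ∧ ¬ IsTwoEnded Γ) :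
    IsOneEnded Γ ↔
      ∀ v : V, IsInfiniteEnded (𝒢.VG v) →
        ¬ SplitsOverFiniteRel (𝒢.VG v) (𝒢.incidentEdgeGroups v) := by
  constructor
  · intro h v _ hs
    obtain ⟨x, hx⟩ := hconn.exists_isPath v₀ v
    exact h.2 ((GraphOfGroups.splits_of_vertexGroup_splits hs).of_equiv
      (φ.trans (GraphOfGroups.fundamentalGroupEquiv hx)))
  · intro hsplit
    rcases isEmpty_or_nonempty E with hE | hE
    · obtain ⟨hinf, htwo⟩ := hpoint hE
      have ψ : 𝒢.VG v₀ ≃* Γ := GraphOfGroups.equivOfIsEmpty.trans φ.symm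
      by_contra hone
      have hone' : ¬ IsOneEnded (𝒢.VG v₀) := fun h => hone (h.of_equiv ψ.symm)
      have hinf' : Infinite (𝒢.VG v₀) := Infinite.of_injective _ ψ.symm.injective
      refine hsplit v₀ ⟨hinf', hone', fun h => htwo (h.of_equiv ψ)⟩ ?_
      have hnone : 𝒢.incidentEdgeGroups v₀ = ∅ := by
        refine Set.eq_empty_of_forall_notMem ?_
        rintro H ⟨e, b⟩
        exact hE.elim e
      rw [hnone]
      by_contra hs
      exact hone' ⟨hinf', hs⟩
    · have hinf := GraphOfGroups.infinite_fundamentalGroup (v₀ := v₀) hconn hedge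
      refine IsOneEnded.of_equiv φ ⟨hinf, ?_⟩
      rintro ⟨T, h1, h2, -⟩
      exact GraphOfGroups.not_nontrivial_of_not_splits hconn hedge htriv hsplit h2 h1
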